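/- **Setting.** Let $F=\mathbb F_q$, let $K=\mathbb F_{q^m}$ be an extension of degree $m$, let $1\le k\le n$, let $g_1,\dots,g_n\in K$ be linearly independent over $\mathbb F_q$, and let $r=(r_1,\dots,r_n)\in K^n$. Let $C\subseteq K^n$ be the Gabidulin code whose generator matrix is the $k\times n$ matrix $(g_j^{q^i})_{0\le i<k,\,1\le j\le n}$. The rank distance of two vectors in $K^n$ is the $\mathbb F_q$-rank of the $m\times n$ matrix of coordinates of their difference. Linearized polynomials are the polynomials $\sum_i a_i x^{q^i}$ over $K$, multiplied by composition $\circ$; the $q$-degree $\mathrm{qdeg}$ is the largest $i$ with $a_i\ne0$ (and $-\infty$ for $0$). The weighted degree of a row $[f_1\ f_2]$ is $\max(\mathrm{qdeg} f_1,\ k-1+\mathrm{qdeg} f_2)$. **The list decoding algorithm.** 1. Start with $\Pi=x$, $\Lambda=0$; for $i=1,\dots,n$ replace $(\Pi,\Lambda)$ by $\big((x^q-\Pi(g_i)^{q-1}x)\circ\Pi,\ \Lambda-\frac{\Lambda(g_i)-r_i}{\Pi(g_i)}\Pi\big)$. Let $\mathfrak M(r)$ be the left module generated by the rows $[\Pi\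 \ 0]$ and $[-\Lambda\ \ x]$. 2. Compute a basis $b^{(1)},b^{(2)}$ of $\mathfrak M(r)$ by one of these two methods. - *Euclidean.* Start with the rows $[P\ K]=[\Pi\ \ 0]$, $[N\ D]=[-\Lambda\ \ x]$. While $\mathrm{qdeg} D+k-1<\mathrm{qdeg} N$, divide $P=p\circ N+s$ with $\mathrm{qdeg}\, s<\mathrm{qdeg} N$ and replace the rows by $[N\ D]$, $[s\ \ K-p\circ D]$. Return the two rows. - *Iterative.* Start with $B=\begin{pmatrix}x&0\\0&x\end{pmatrix}$. For $i=1,\dots,n$ put $\Gamma=B_{11}(g_i)+B_{12}(r_i)$, $\Delta=B_{21}(g_i)+B_{22}(r_i)$. If ($\mathrm{qdeg} B_{11}\le\mathrm{qdeg} B_{22}+k-1$ and $\Gamma\ne0$) or $\Delta=0$, replace $B$ by $\begin{pmatrix}x^q-\Gamma^{q-1}x&0\\ \Delta x&-\Gamma x\end{pmatrix}\circ B$, and otherwise by $\begin{pmatrix}\Delta x&-\Gamma x\\0&x^q-\Delta^{q-1}x\end{pmatrix}\circ B$. Return the rows of $B$. 3. Let $\ell_1,\ell_2$ be the weighted degrees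 of $b^{(1)},b^{(2)}$. For $j=0,1,2,\dots$, and for all linearized polynomials $\beta$ with $\mathrm{qdeg}\,\beta\le\ell_2-\ell_1+j$ and all monic $\gamma$ with $\mathrm{qdeg}\,\gamma=j$, form $[f_1\ f_2]=\beta\circ b^{(1)}+\gamma\circ b^{(2)}$ and, by left symbolic division, add $m$ to the list if $f_1=f_2\circ m$ for a linearized polynomial $m$. Stop and return the list after the first $j$ for which it is nonempty. Linearized polynomials are stored as coefficient lists, and composition and left and right symbolic division are done by the schoolbook methods. An operation is an addition, subtraction, multiplication, division, test for zero, or power $a\mapsto a^{q^i}$ in $K$ (the powers are cyclic shifts in a normal basis; counting them only increases the count). Writing down $\beta$ and $\gamma$ is charged one operation per coefficient. **Theorem.** There is an absolute constant $c$ such that for all $q,m,n,k,g,r$ as above, for each of the two methods in step 2, and for every order in which the elements of $K$ are enumerated in step 3, the algorithm stops after at most $$c\left(q^{m(2t+k-n)}(t+k)^2+n^2\right)$$ operations, where $t$ is the minimum of the rank distances between $r$ and the codewords of $C$. Moreover, if $t\ge n-k$, then the number of operations is at most $$c\left(\big(q^{m(2t+k-n)}+1\big)n^2\right).$$ -/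

import Mathlib

namespace Gabidulin

/-! ### The code and the rank metric -/

/-- The `k × n` Moore matrix `(g_j ^ (q ^ i))`, where `q = |F|`. -/
def mooreMatrix (F : Type*) {K : Type*} [Fintype F] [Field K] {n : ℕ} (k : ℕ) (g : Fin n → K) :
    Matrix (Fin k) (Fin n) K :=
  Matrix.of fun i j => g j ^ (Fintype.card F ^ (i : ℕ))

/-- The Gabidulin code: the `K`-row space of the Moore matrix. -/
def code (F : Type*) {K : Type*} [Fintype F] [Field K] {n : ℕ} (k : ℕ) (g : Fin n → K) :
    Submodule K (Fin n → K) :=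
  Submodule.span K (Set.range (mooreMatrix F k g).row)

/-- A vector over `K` as a matrix over `F`: column `j` is the coordinate vector of `x j`. -/
noncomputable def expand (F : Type*) {K : Type*} [Field F] [Field K] [Algebra F K]
    [FiniteDimensional F K] {n : ℕ} (x : Fin n → K) :
    Matrix (Fin (Module.finrank F K)) (Fin n) F :=
  Matrix.of fun i j => (Module.finBasis F K).repr (x j) i

/-- The rank distance `rank_F (X - Y)`. -/
noncomputable def rankDist (F : Type*) {K : Type*} [Field F] [Field K] [Algebra F K]
    [FiniteDimensional F K] {n : ℕ} (x y : Fin n → K) : ℕ :=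
  (expand F x - expand F y).rank

/-! ### Counted computations -/

/-- Computations that carry the number of operations performed so far as their state. The value
`none` is the result of a loop that never stops. -/
abbrev Comp := StateT ℕ Option

/-- Charge `c` operations. -/
def charge (c : ℕ) : Comp Unit := modify (· + c)

/-- A unit-cost operation with result `a`. -/
def op {α : Type} (a : α) : Comp α := do
  charge 1
  pure a

/-- Repeat `step`, starting from `s`, until it answers `Sum.inr a`; then return `a`. -/
def whileLoop {σ α : Type} (step : σ → Comp (σ ⊕ α)) (s : σ) : Comp α := do
  match (← step s) with
  | Sum.inl s' => whileLoop step s'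
  | Sum.inr a => pure a
  partial_fixpoint

section Programs

variable {K : Type} [Field K] [DecidableEq K]

def addE (a b : K) : Comp K := op (a + b)

def subE (a b : K) : Comp K := op (a - b)

def mulE (a b : K) : Comp K := op (a * b)

def divE (a b : K) : Comp K := op (a / b)

def isZeroE (a : K) : Comp Bool := op (decide (a = 0))

/-- The map `a ↦ a ^ (q ^ i)`: a cyclic shift by `i` positions in a normal basis. -/
def frobE (q i : ℕ) (a : K) : Comp K := op (a ^ (q ^ i))

/-! ### Linearized polynomials

The list `[a₀, a₁, …, a_d]` stands for `a₀ x + a₁ x ^ q + ⋯ + a_d x ^ (q ^ d)`. -/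

/-- Remove the leading zero coefficients. -/
def trim : List K → Comp (List K)
  | [] => pure []
  | a :: f => do
    let h ← trim f
    match h with
    | [] => do
      let z ← isZeroE a
      pure (if z then [] else [a])
    | b :: h' => pure (a :: b :: h')

/-- The `q`-degree, `⊥` for the zero polynomial, of a list without leading zero coefficients. -/
def qdeg : List K → WithBot ℕ
  | [] => ⊥
  | _ :: f => (f.length : WithBot ℕ)

def addP : List K → List K → Comp (List K)
  | [], g => pure g
  | a :: f, [] => pure (a :: f)
  | a :: f, b :: g => do
    let c ← addE a b
    let h ← addP f g
    pure (c :: h)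

def subP : List K → List K → Comp (List K)
  | [], [] => pure []
  | a :: f, [] => pure (a :: f)
  | [], b :: g => do
    let c ← subE 0 b
    let h ← subP [] g
    pure (c :: h)
  | a :: f, b :: g => do
    let c ← subE a b
    let h ← subP f g
    pure (c :: h)

/-- The polynomial `c • f`. -/
def smulP (c : K) (f : List K) : Comp (List K) := f.mapM (mulE c)

/-- All coefficients raised to the power `q ^ i`. -/
def frobP (q i : ℕ) (f : List K) : Comp (List K) := f.mapM (frobE q i)

/-- The value `f(x)`. -/
def evalP (q : ℕ) : List K → K → Comp K
  | [], _ => pure 0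
  | a :: f, x => do
    let y ← mulE a x
    let x' ← frobE q 1 x
    let z ← evalP q f x'
    addE y z

/-- The composition `f ∘ g`, possibly with leading zeros, from
`(a x + f(x ^ q)) ∘ g = a g + (f ∘ g')(x ^ q)`, where `g'` has the coefficients of `g` raised to
the power `q`. -/
def compAux (q : ℕ) : List K → List K → Comp (List K)
  | [], _ => pure []
  | a :: f, g => do
    let h ← smulP a g
    let g' ← frobP q 1 g
    let p ← compAux q f g'
    addP h (0 :: p)

/-- The composition `f ∘ g`. -/
def compP (q : ℕ) (f g : List K) : Comp (List K) := do
  let h ← compAux q f g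
  trim h

/-- Long division of `f` by `g` on the right, for `f` of length at most `g.length + s - 1`. -/
def divRightAux (q : ℕ) (g : List K) : ℕ → List K → Comp (List K × List K)
  | 0, f => pure ([], f)
  | d + 1, f => do
    let b ← frobE q d (g.getLastD 0)
    let c ← divE (f.getLastD 0) b
    let gd ← frobP q d g
    let h ← smulP c gd
    let f' ← subP f (List.replicate d 0 ++ h)
    let (p, r) ← divRightAux q g d f'.dropLast
    pure (p ++ [c], r)

/-- Right symbolic division: `(p, r)` with `f = p ∘ g + r` and `qdeg r < qdeg g`. -/
def divRight (q : ℕ) (f g : List K) : Comp (List K × List K) := do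
  let (p, r) ← divRightAux q g (f.length + 1 - g.length) f
  let p' ← trim p
  let r' ← trim r
  pure (p', r')

/-- Long division of `f` by `g` on the left, for `f` of length at most `g.length + s - 1`. Here
`a ↦ a ^ (q ^ ((m - 1) * e))` is the inverse of `a ↦ a ^ (q ^ e)`. -/
def divLeftAux (q m : ℕ) (g : List K) : ℕ → List K → Comp (List K × List K)
  | 0, f => pure ([], f)
  | d + 1, f => do
    let a ← divE (f.getLastD 0) (g.getLastD 0)
    let c ← frobE q ((m - 1) * (g.length - 1)) a
    let h ← compAux q g [c]
    let f' ← subP f (List.replicate d 0 ++ h)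
    let (p, r) ← divLeftAux q m g d f'.dropLast
    pure (p ++ [c], r)

/-- Left symbolic division: `some p` if `f = g ∘ p`, and `none` if there is no such `p`
(for `g = 0` and `f = 0` the answer is `some 0`). -/
def quotientLeft (q m : ℕ) (f g : List K) : Comp (Option (List K)) :=
  if g = [] then pure (if f = [] then some [] else none)
  else do
    let (p, r) ← divLeftAux q m g (f.length + 1 - g.length) f
    let p' ← trim p
    let r' ← trim r
    pure (if r' = [] then some p' else none)

/-! ### The algorithms -/

/-- The composition `(x ^ q - u ^ (q - 1) x) ∘ f`. -/
def annihilateP (q : ℕ) (u : K) (f : List K) : Comp (List K) := do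
  let uq ← frobE q 1 u
  let e ← divE uq u
  let f' ← frobP q 1 f
  let h ← smulP e f
  let p ← subP (0 :: f') h
  trim p

/-- The polynomial `a f - b h`. -/
def combineP (a b : K) (f h : List K) : Comp (List K) := do
  let f' ← smulP a f
  let h' ← smulP b h
  let p ← subP f' h'
  trim p

/-- The recursive construction of the annihilator polynomial of `g₁, …, g_n` and the Lagrange
polynomial with `g_i ↦ r_i`, from the pair `(Π, Λ)` for the points already treated. -/
def annLag (q : ℕ) : List (K × K) → List K → List K → Comp (List K × List K)
  | [], P, L => pure (P, L)
  | (g, r) :: pts, P, L => do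
    let u ← evalP q P g
    let v ← evalP q L g
    let w ← subE v r
    let s ← divE w u
    let h ← smulP s P
    let l ← subP L h
    let L' ← trim l
    let P' ← annihilateP q u P
    annLag q pts P' L'

/-- A `2 × 2` matrix of linearized polynomials: `((b₁₁, b₁₂), (b₂₁, b₂₂))`. -/
abbrev Mat (K : Type) := (List K × List K) × (List K × List K)

/-- One round of the extended Euclidean algorithm on `((P, M), (N, D))`. -/
def euclidStep (q k : ℕ) : Mat K → Comp (Mat K ⊕ Mat K)
  | ((P, M), (N, D)) =>
    if qdeg D + ((k - 1 : ℕ) : WithBot ℕ) < qdeg N then do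
      let (p, r) ← divRight q P N
      let h ← compP q p D
      let l ← subP M h
      let M' ← trim l
      pure (Sum.inl ((N, D), (r, M')))
    else pure (Sum.inr ((P, M), (N, D)))

/-- Minimal basis of the interpolation module by the extended Euclidean algorithm. -/
def euclidBasis (q k : ℕ) (P L : List K) : Comp (Mat K) := do
  let N ← subP [] L
  whileLoop (euclidStep q k) ((P, []), (N, [1]))

/-- Minimal basis of the interpolation module by the iterative algorithm, from the matrix
`((P, -M), (N, -D))` for the points already treated. -/
def iterativeBasis (q k : ℕ) : List (K × K) → Mat K → Comp (Mat K)
  | [], B => pure B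
  | (g, r) :: pts, ((P, M), (N, D)) => do
    let p ← evalP q P g
    let u ← evalP q M r
    let c ← addE p u
    let p' ← evalP q N g
    let u' ← evalP q D r
    let d ← addE p' u'
    let cz ← isZeroE c
    let dz ← isZeroE d
    if (qdeg P ≤ qdeg D + ((k - 1 : ℕ) : WithBot ℕ) ∧ cz = false) ∨ dz = true then do
      let P' ← annihilateP q c P
      let M' ← annihilateP q c M
      let N' ← combineP d c P N
      let D' ← combineP d c M D
      iterativeBasis q k pts ((P', M'), (N', D'))
    else do
      let P' ← combineP d c P N
      let M' ← combineP d c M D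
      let N' ← annihilateP q d N
      let D' ← annihilateP q d D
      iterativeBasis q k pts ((P', M'), (N', D'))

/-- The two ways to compute the minimal basis. -/
inductive BasisMethod
  | euclid
  | iterative

/-- The `(0, k - 1)`-weighted `q`-degree of the nonzero row `(f₁, f₂)`. -/
def weightedDeg (k : ℕ) (f : List K × List K) : ℤ :=
  ((max (qdeg f.1) (qdeg f.2 + ((k - 1 : ℕ) : WithBot ℕ))).unbotD 0 : ℕ)

/-- All lists of `d` field elements, where `elems` enumerates the field. -/
def allLists (elems : List K) : ℕ → List (List K)
  | 0 => [[]]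
  | d + 1 => (allLists elems d).flatMap fun f => elems.map fun a => a :: f

/-- The body of the two inner loops: form `f = β ∘ b₁ + γ ∘ b₂` and look for `m` with
`f₁ = f₂ ∘ m`. Writing down `β` and `γ` is charged one operation per coefficient. -/
def tryPair (q m : ℕ) (B : Mat K) : List K × List K → Comp (Option (List K))
  | (β₀, γ) => do
    charge (β₀.length + γ.length)
    let β ← trim β₀
    let h₁ ← compP q β B.1.1
    let h₂ ← compP q γ B.2.1
    let l₁ ← addP h₁ h₂
    let f₁ ← trim l₁
    let h₃ ← compP q β B.1.2
    let h₄ ← compP q γ B.2.2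
    let l₂ ← addP h₃ h₄
    let f₂ ← trim l₂
    quotientLeft q m f₁ f₂

/-- One round of the outer loop. The polynomials `β` with `qdeg β ≤ ℓ₂ - ℓ₁ + j` have
`ℓ₂ - ℓ₁ + j + 1` coefficients (`β = 0` if this number is negative), and the monic `γ` with
`qdeg γ = j` have `j` free coefficients. -/
def searchStep (q m k : ℕ) (elems : List K) (B : Mat K) (j : ℕ) :
    Comp (ℕ ⊕ List (List K)) := do
  let βs := allLists elems (weightedDeg k B.2 - weightedDeg k B.1 + j + 1).toNat
  let γs := (allLists elems j).map fun γ => γ ++ [1]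
  let found ← (βs.product γs).mapM (tryPair q m B)
  let out := found.reduceOption
  pure (if out = [] then Sum.inl (j + 1) else Sum.inr out)

/-- The minimal list decoder for the generators and received word `pts = [(g₁, r₁), …]`. -/
def listDecode (q m k : ℕ) (elems : List K) (method : BasisMethod) (pts : List (K × K)) :
    Comp (List (List K)) := do
  let (P, L) ← annLag q pts [1] []
  let B ← match method with
    | BasisMethod.euclid => euclidBasis q k P L
    | BasisMethod.iterative => iterativeBasis q k pts (([1], []), ([], [1]))
  whileLoop (searchStep q m k elems B) 0

end Programs

end Gabidulin

/-!
The linearized polynomial `∑ aᵢ x ^ (q ^ i)` is encoded by the ordinary polynomial `∑ aᵢ Xⁱ`, on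
which composition becomes the multiplication `skewMul` of a skew polynomial ring and evaluation
becomes `value`. Degrees add under `skewMul`, so there are no zero divisors.

The rows `(f₁, f₂)` with `f₁(gᵢ) + f₂(rᵢ) = 0` for all `i` form the interpolation module. Suppose
that two of its rows, `(P, M)` and `(N, D)`, have leading positions one and two for the
`(0, k - 1)`-weighted degree (`IsReducedPair`). Every row can be reduced modulo them to one with
entries of degree below `deg P` and `deg D`, and reduction does not change the vector of values at
the `n` points. Every vector of values is attained, because the `gᵢ` are independent, so comparing
dimensions gives `n ≤ deg P + deg D`, and in the case of equality a reduced row in the module is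
zero: the two rows generate the module (`IsReducedPair.exists_combination`). Hence both basis
methods only have to be shown to preserve membership and leading positions and to keep
`deg P + deg D` equal to the number of points treated. The inequality, applied to one more point,
shows that the two discrepancies of the iterative algorithm never vanish together. The Euclidean
loop costs `O(n)` operations for each coefficient of a quotient, and the lengths of the quotients
are paid for by the decrease of the lengths of the first column.

A closest codeword, with message polynomial `-μ`, gives the row `(E ∘ μ, E)` of the module, where
`E` annihilates the `t`-dimensional space spanned by the errors and has degree at most `t`
(`exists_decodable`). Its leading position is the second one, so in its expression
`β ∘ (P, M) + γ ∘ (N, D)` the degrees of `β` and `γ` obey the bounds of round `J = deg E - deg D`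
of the search, and the search stops in that round at the latest (`exists_hit`). If round `J` allows
a nonzero `β`, then the number of pairs it forms is `|K| ^ e` with `e = 2 deg E + k - n`; the
exponents of the rounds increase strictly, so all rounds together form at most twice as many pairs,
and each pair costs `O((deg E + k) ^ 2)` operations. Otherwise `β = 0`, and cancelling `γ` in
`γ ∘ N = γ ∘ D ∘ μ` shows that the single pair of round `0` already passes the test, at a cost of
`O(n ^ 2)`. The bound for `t ≥ n - k` follows from the first one, since `t ≤ n` and `k ≤ n`.
-/

namespace Gabidulin

open Polynomial

/-! ### Skew polynomials and linearized polynomials -/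

section Skew

variable {K : Type*} [Field K] (φ : K →+* K)

/-- The value at `x` of the linearized polynomial `∑ aᵢ φⁱ`, which is encoded by the ordinary
polynomial `∑ aᵢ Xⁱ`. It is linear in the polynomial. -/
noncomputable def value (x : K) : K[X] →ₗ[K] K :=
  Polynomial.lsum fun i => LinearMap.toSpanSingleton K K ((φ ^ i) x)

/-- The composition of two linearized polynomials, on their encodings: the product of the skew
polynomial ring in which `X * a = φ a * X`. -/
noncomputable def skewMul (f g : K[X]) : K[X] :=
  Polynomial.lsum (fun i => LinearMap.toSpanSingleton K K[X] (X ^ i * g.map (φ ^ i))) f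

variable {φ}

@[simp] lemma value_monomial (x : K) (i : ℕ) (a : K) :
    value φ x (monomial i a) = a * (φ ^ i) x := by
  simp [value, Polynomial.lsum, sum_monomial_index]

@[simp] lemma skewMul_monomial (i : ℕ) (a : K) (g : K[X]) :
    skewMul φ (monomial i a) g = C a * (X ^ i * g.map (φ ^ i)) := by
  simp [skewMul, Polynomial.lsum, sum_monomial_index, smul_eq_C_mul]

@[simp] lemma skewMul_zero_left (g : K[X]) : skewMul φ 0 g = 0 := by simp [skewMul]

lemma skewMul_add_left (f f' g : K[X]) :
    skewMul φ (f + f') g = skewMul φ f g + skewMul φ f' g := map_add _ _ _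

lemma skewMul_sub_left (f f' g : K[X]) :
    skewMul φ (f - f') g = skewMul φ f g - skewMul φ f' g := map_sub _ _ _

lemma skewMul_C_mul_left (a : K) (f g : K[X]) :
    skewMul φ (C a * f) g = C a * skewMul φ f g := by
  rw [← smul_eq_C_mul, ← smul_eq_C_mul]
  exact map_smul _ _ _

lemma skewMul_add_right (f g g' : K[X]) :
    skewMul φ f (g + g') = skewMul φ f g + skewMul φ f g' := by
  induction f using Polynomial.induction_on' with
  | add p q hp hq => rw [skewMul_add_left, hp, hq, skewMul_add_left, skewMul_add_left]; ring
  | monomial n a => simp; ring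

@[simp] lemma skewMul_zero_right (f : K[X]) : skewMul φ f 0 = 0 := by
  have := skewMul_add_right (φ := φ) f 0 0
  simpa using this

lemma skewMul_neg_right (f g : K[X]) : skewMul φ f (-g) = -skewMul φ f g := by
  have := skewMul_add_right (φ := φ) f g (-g)
  rw [add_neg_cancel, skewMul_zero_right] at this
  exact (neg_eq_of_add_eq_zero_right this.symm).symm

lemma skewMul_sub_right (f g g' : K[X]) :
    skewMul φ f (g - g') = skewMul φ f g - skewMul φ f g' := by
  rw [sub_eq_add_neg, skewMul_add_right, skewMul_neg_right, sub_eq_add_neg]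

@[simp] lemma skewMul_one_left (g : K[X]) : skewMul φ 1 g = g := by
  rw [show (1 : K[X]) = monomial 0 1 by simp, skewMul_monomial]
  simp [RingHom.one_def]

@[simp] lemma skewMul_C_left (a : K) (g : K[X]) : skewMul φ (C a) g = C a * g := by
  rw [← mul_one (C a), skewMul_C_mul_left]; simp

lemma skewMul_X_mul (f g : K[X]) : skewMul φ (X * f) g = X * skewMul φ f (g.map φ) := by
  induction f using Polynomial.induction_on' with
  | add p q hp hq => rw [mul_add, skewMul_add_left, hp, hq, skewMul_add_left, mul_add]
  | monomial n a =>
    rw [X_mul_monomial, skewMul_monomial, skewMul_monomial, map_map, pow_succ, pow_succ,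
      RingHom.mul_def]
    ring

lemma value_C (x a : K) : value φ x (C a) = a * x := by
  rw [← monomial_zero_left, value_monomial]; simp

lemma value_X_mul (x : K) (f : K[X]) : value φ x (X * f) = value φ (φ x) f := by
  induction f using Polynomial.induction_on' with
  | add p q hp hq => rw [mul_add, map_add, hp, hq, map_add]
  | monomial n a => simp [X_mul_monomial, pow_succ]

lemma value_C_mul (x a : K) (f : K[X]) : value φ x (C a * f) = a * value φ x f := by
  rw [← smul_eq_C_mul, map_smul, smul_eq_mul]

lemma value_add_point (x y : K) (f : K[X]) :
    value φ (x + y) f = value φ x f + value φ y f := by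
  induction f using Polynomial.induction_on' with
  | add p q hp hq => rw [map_add, hp, hq, map_add, map_add]; ring
  | monomial n a => simp [mul_add]

@[simp] lemma value_zero_point (f : K[X]) : value φ 0 f = 0 := by
  simpa using value_add_point (φ := φ) 0 0 f

lemma value_neg_point (x : K) (f : K[X]) : value φ (-x) f = -value φ x f := by
  have := value_add_point (φ := φ) x (-x) f
  rw [add_neg_cancel, value_zero_point] at this
  exact (neg_eq_of_add_eq_zero_right this.symm).symm

lemma value_map (x : K) (f : K[X]) : value φ (φ x) (f.map φ) = φ (value φ x f) := by
  induction f using Polynomial.induction_on' with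
  | add p q hp hq => simp [hp, hq]
  | monomial n a =>
    simp only [map_monomial, value_monomial, map_mul, mul_eq_mul_left_iff]
    left
    rw [← RingHom.comp_apply, ← RingHom.comp_apply, ← RingHom.mul_def, ← RingHom.mul_def,
      ← pow_succ, ← pow_succ']

lemma value_X_pow_mul_map (x : K) (i : ℕ) (g : K[X]) :
    value φ x (X ^ i * g.map (φ ^ i)) = (φ ^ i) (value φ x g) := by
  induction i with
  | zero => simp [RingHom.one_def]
  | succ i ih =>
    have h : X ^ (i + 1) * g.map (φ ^ (i + 1)) = X * (X ^ i * g.map (φ ^ i)).map φ := by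
      rw [pow_succ' φ, RingHom.mul_def, ← map_map, Polynomial.map_mul, Polynomial.map_pow, map_X]
      ring
    rw [h, value_X_mul, value_map, ih, pow_succ' φ, RingHom.mul_def, RingHom.comp_apply]

lemma value_skewMul (x : K) (f g : K[X]) :
    value φ x (skewMul φ f g) = value φ (value φ x g) f := by
  induction f using Polynomial.induction_on' with
  | add p q hp hq => rw [skewMul_add_left, map_add, hp, hq, map_add]
  | monomial n a => rw [skewMul_monomial, value_C_mul, value_X_pow_mul_map, value_monomial]

lemma map_skewMul (f g : K[X]) :
    (skewMul φ f g).map φ = skewMul φ (f.map φ) (g.map φ) := by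
  induction f using Polynomial.induction_on' with
  | add p q hp hq =>
    rw [skewMul_add_left, Polynomial.map_add, hp, hq, Polynomial.map_add, skewMul_add_left]
  | monomial n a =>
    rw [skewMul_monomial, map_monomial, skewMul_monomial, Polynomial.map_mul, Polynomial.map_mul,
      map_C, Polynomial.map_pow, map_X, map_map, map_map, ← RingHom.mul_def, ← RingHom.mul_def,
      ← pow_succ, ← pow_succ']

lemma skewMul_X_pow_mul_map (i : ℕ) (f g : K[X]) :
    skewMul φ (X ^ i * f.map (φ ^ i)) g = X ^ i * (skewMul φ f g).map (φ ^ i) := by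
  induction i with
  | zero => simp [RingHom.one_def]
  | succ i ih =>
    have h (f : K[X]) : X ^ (i + 1) * f.map (φ ^ (i + 1)) = X * (X ^ i * f.map (φ ^ i)).map φ := by
      rw [pow_succ' φ, RingHom.mul_def, ← map_map, Polynomial.map_mul, Polynomial.map_pow, map_X]
      ring
    rw [h, h, skewMul_X_mul, ← map_skewMul, ih]

lemma skewMul_assoc (f g h : K[X]) :
    skewMul φ (skewMul φ f g) h = skewMul φ f (skewMul φ g h) := by
  induction f using Polynomial.induction_on' with
  | add p q hp hq => rw [skewMul_add_left, skewMul_add_left, hp, hq, skewMul_add_left]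
  | monomial n a =>
    rw [skewMul_monomial, skewMul_C_mul_left, skewMul_X_pow_mul_map, skewMul_monomial]

lemma degree_skewMul_monomial (i : ℕ) {a : K} (ha : a ≠ 0) (g : K[X]) :
    (skewMul φ (monomial i a) g).degree = i + g.degree := by
  rw [skewMul_monomial, degree_mul, degree_C ha, degree_mul, degree_X_pow, degree_map, zero_add]

lemma degree_skewMul (f g : K[X]) : (skewMul φ f g).degree = f.degree + g.degree := by
  by_cases hg : g = 0
  · simp [hg]
  induction hn : f.support.card using Nat.strong_induction_on generalizing f with
  | _ n ih =>
    by_cases hf : f = 0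
    · simp [hf]
    have hlead := degree_skewMul_monomial (φ := φ) f.natDegree (leadingCoeff_ne_zero.mpr hf) g
    have hrest := ih _ (hn ▸ eraseLead_support_card_lt hf) _ rfl
    have hlt : (skewMul φ f.eraseLead g).degree <
        (skewMul φ (monomial f.natDegree f.leadingCoeff) g).degree := by
      rw [hrest, hlead, ← degree_eq_natDegree hf]
      exact WithBot.add_lt_add_right (degree_ne_bot.mpr hg) (degree_eraseLead_lt hf)
    conv_lhs => rw [← f.eraseLead_add_monomial_natDegree_leadingCoeff, skewMul_add_left]
    rw [degree_add_eq_right_of_degree_lt hlt, hlead, degree_eq_natDegree hf]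

/-- The skew polynomial ring has no zero divisors. -/
lemma skewMul_left_cancel {f g h : K[X]} (hf : f ≠ 0) (e : skewMul φ f g = skewMul φ f h) :
    g = h := by
  have h1 : (skewMul φ f (g - h)).degree = ⊥ := by rw [skewMul_sub_right, e, sub_self, degree_zero]
  rw [degree_skewMul, WithBot.add_eq_bot, degree_eq_bot, degree_eq_bot, sub_eq_zero] at h1
  exact h1.resolve_left hf

end Skew

/-! ### The interpolation module -/

section Module

lemma le_of_lt_succ {a : WithBot ℕ} {n : ℕ} (h : a < (n + 1 : ℕ)) : a ≤ n := by
  cases a with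
  | bot => simp
  | coe a =>
    simp only [Nat.cast_withBot, WithBot.coe_lt_coe, WithBot.coe_le_coe] at *
    omega

lemma add_lt_of_lt_of_add_lt_succ {a b : WithBot ℕ} {w n : ℕ} (h : a < b)
    (h' : b + w < (n + 1 : ℕ)) : a + w < n := by
  cases b with
  | bot => simp at h
  | coe b =>
    cases a with
    | bot => simp
    | coe a =>
      simp only [Nat.cast_withBot, WithBot.coe_lt_coe, ← WithBot.coe_add] at *
      omega

lemma lt_of_add_lt_of_add_le {a b c d : WithBot ℕ} {w : ℕ} (ha : a ≠ ⊥) (h : b + w < c)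
    (h' : a + c ≤ d + w) : a + b < d := by
  cases a with
  | bot => exact absurd rfl ha
  | coe a =>
    cases c with
    | bot => simp at h
    | coe c =>
      cases d with
      | bot => simp [← WithBot.coe_add] at h'
      | coe d =>
        cases b with
        | bot => simp
        | coe b =>
          simp only [Nat.cast_withBot, WithBot.coe_lt_coe, WithBot.coe_le_coe,
            ← WithBot.coe_add] at *
          omega

variable {K : Type*} [Field K] {φ : K →+* K}

/-- A left multiple of `g` that cancels the leading term of `f`. -/
lemma exists_monomial_cancel {f g : K[X]} (hf : f ≠ 0) (hg : g ≠ 0) (h : g.degree ≤ f.degree) :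
    ∃ β : K[X], (skewMul φ β g).degree = f.degree ∧ (f - skewMul φ β g).degree < f.degree := by
  have hle : g.natDegree ≤ f.natDegree := natDegree_le_natDegree h
  set e := f.natDegree - g.natDegree
  have hc : (φ ^ e) g.leadingCoeff ≠ 0 :=
    (_root_.map_ne_zero _).mpr (leadingCoeff_ne_zero.mpr hg)
  set c := f.leadingCoeff / (φ ^ e) g.leadingCoeff
  have hc0 : c ≠ 0 := div_ne_zero (leadingCoeff_ne_zero.mpr hf) hc
  have hdeg : (skewMul φ (monomial e c) g).degree = f.degree := by
    rw [degree_skewMul_monomial _ hc0, degree_eq_natDegree hg, degree_eq_natDegree hf]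
    norm_cast
    omega
  refine ⟨monomial e c, hdeg, degree_sub_lt_left hdeg.symm hf ?_⟩
  rw [skewMul_monomial, leadingCoeff_mul, leadingCoeff_mul, leadingCoeff_C, leadingCoeff_X_pow,
    leadingCoeff_map, one_mul, div_mul_cancel₀ _ hc]

/-- Division of the row `(f₁, f₂)` by the rows `(P, M)` and `(N, D)`, whose leading positions are
the first and the second one. The induction is on a bound for the `(0, w)`-weighted degree. -/
lemma exists_reduction {P M N D : K[X]} {w : ℕ} (h1 : M.degree + w < P.degree)
    (h2 : N.degree ≤ D.degree + w) (hD : D ≠ 0) (f₁ f₂ : K[X]) :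
    ∃ β γ s₁ s₂ : K[X], f₁ = skewMul φ β P + skewMul φ γ N + s₁ ∧
      f₂ = skewMul φ β M + skewMul φ γ D + s₂ ∧ s₁.degree < P.degree ∧ s₂.degree < D.degree := by
  have hP : P ≠ 0 := by rintro rfl; simp at h1
  have hP' : (⊥ : WithBot ℕ) < P.degree := bot_lt_iff_ne_bot.mpr (degree_ne_bot.mpr hP)
  have hD' : (⊥ : WithBot ℕ) < D.degree := bot_lt_iff_ne_bot.mpr (degree_ne_bot.mpr hD)
  suffices H : ∀ (ω : ℕ) (f₁ f₂ : K[X]), f₁.degree < ω → f₂.degree + w < ω →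
      ∃ β γ s₁ s₂ : K[X], f₁ = skewMul φ β P + skewMul φ γ N + s₁ ∧
      f₂ = skewMul φ β M + skewMul φ γ D + s₂ ∧ s₁.degree < P.degree ∧ s₂.degree < D.degree by
    apply H (f₁.natDegree + f₂.natDegree + w + 1)
    · exact degree_le_natDegree.trans_lt (by norm_cast; omega)
    · exact (add_le_add_left degree_le_natDegree _).trans_lt (by norm_cast; omega)
  intro ω
  induction ω with
  | zero =>
    intro f₁ f₂ hf₁ hf₂
    have e₁ : f₁ = 0 := by simpa using hf₁
    have e₂ : f₂ = 0 := by
      by_contra h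
      rw [degree_eq_natDegree h] at hf₂
      norm_cast at hf₂
    exact ⟨0, 0, 0, 0, by simp [e₁], by simp [e₂], by simpa using hP', by simpa using hD'⟩
  | succ ω ih =>
    intro f₁ f₂ hf₁ hf₂
    -- Cancel or split off the leading term of the second entry. The multiple of `(N, D)` that is
    -- needed keeps the first entry within the bound, because `(N, D)` has leading position two.
    obtain ⟨γ₀, s₂, hγ₀, hs₂, hf₂'⟩ : ∃ γ₀ s₂ : K[X], (skewMul φ γ₀ N).degree < (ω + 1 : ℕ) ∧
        s₂.degree < D.degree ∧ (f₂ - skewMul φ γ₀ D - s₂).degree + w < ω := by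
      by_cases c1 : f₂.degree < D.degree
      · exact ⟨0, f₂, by simp, c1, by simp⟩
      · have hf0 : f₂ ≠ 0 := by rintro rfl; simp at c1; exact hD c1
        obtain ⟨γ₀, e, hlt⟩ := exists_monomial_cancel (φ := φ) hf0 hD (not_lt.mp c1)
        refine ⟨γ₀, 0, ?_, by simpa using hD', ?_⟩
        · rw [degree_skewMul] at e ⊢
          calc _ ≤ γ₀.degree + (D.degree + w) := add_le_add_right h2 _
            _ = f₂.degree + w := by rw [← add_assoc, e]
            _ < _ := hf₂
        · rw [sub_zero]
          exact add_lt_of_lt_of_add_lt_succ hlt hf₂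
    -- Do the same for the first entry. The multiple of `(P, M)` affects only lower terms of the
    -- second entry, because `(P, M)` has leading position one.
    have hf₁' : (f₁ - skewMul φ γ₀ N).degree < (ω + 1 : ℕ) :=
      (degree_sub_le _ _).trans_lt (max_lt hf₁ hγ₀)
    set g₁ := f₁ - skewMul φ γ₀ N with hg₁
    obtain ⟨β₀, s₁, hβ₀, hs₁, hf₁''⟩ : ∃ β₀ s₁ : K[X], (skewMul φ β₀ M).degree + w < ω ∧
        s₁.degree < P.degree ∧ (g₁ - skewMul φ β₀ P - s₁).degree < ω := by
      by_cases c1 : g₁.degree < P.degree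
      · exact ⟨0, g₁, by simp, c1, by simp⟩
      · have hf0 : g₁ ≠ 0 := by intro h; simp [h] at c1; exact hP c1
        obtain ⟨β₀, e, hlt⟩ := exists_monomial_cancel (φ := φ) hf0 hP (not_lt.mp c1)
        have hb : β₀.degree ≠ ⊥ := by
          intro h
          rw [degree_skewMul, h, WithBot.bot_add] at e
          exact hf0 (degree_eq_bot.mp e.symm)
        have hlt' : (skewMul φ β₀ M).degree + w < g₁.degree := by
          rw [← e, degree_skewMul, degree_skewMul, add_assoc]
          exact WithBot.add_lt_add_left hb h1
        have hle : g₁.degree ≤ ω := le_of_lt_succ hf₁'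
        exact ⟨β₀, 0, hlt'.trans_le hle, by simpa using hP', by
          rw [sub_zero]; exact hlt.trans_le hle⟩
    obtain ⟨β, γ, u₁, u₂, e₁, e₂, hu₁, hu₂⟩ := ih (g₁ - skewMul φ β₀ P - s₁)
      (f₂ - skewMul φ γ₀ D - s₂ - skewMul φ β₀ M) hf₁'' (by
        rcases le_total (f₂ - skewMul φ γ₀ D - s₂).degree (skewMul φ β₀ M).degree with h | h
        · exact (add_le_add_left ((degree_sub_le _ _).trans (max_le h le_rfl)) _).trans_lt hβ₀
        · exact (add_le_add_left ((degree_sub_le _ _).trans (max_le le_rfl h)) _).trans_lt hf₂')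
    refine ⟨β + β₀, γ + γ₀, u₁ + s₁, u₂ + s₂, ?_, ?_,
      (degree_add_le _ _).trans_lt (max_lt hu₁ hs₁), (degree_add_le _ _).trans_lt (max_lt hu₂ hs₂)⟩
    · rw [skewMul_add_left, skewMul_add_left]
      linear_combination e₁ + hg₁
    · rw [skewMul_add_left, skewMul_add_left]
      linear_combination e₂

variable (φ) in
/-- A linearized polynomial that vanishes on the points of `l` is zero or has at least as large a
`q`-degree as there are points. For a Frobenius map this is a consequence of linear independence. -/
def IsIndep (l : List K) : Prop :=
  ∀ p : K[X], p ≠ 0 → (∀ x ∈ l, value φ x p = 0) → (l.length : WithBot ℕ) ≤ p.degree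

variable (φ) in
/-- The row `(f₁, f₂)` belongs to the interpolation module of the points `pts`. -/
def Interpolates (pts : List (K × K)) (f₁ f₂ : K[X]) : Prop :=
  ∀ x ∈ pts, value φ x.1 f₁ + value φ x.2 f₂ = 0

variable (φ) in
/-- The rows `(P, M)` and `(N, D)` belong to the interpolation module, and their leading positions
with respect to the `(0, w)`-weighted degree are the first and the second one, where a tie counts
for the second position. -/
structure IsReducedPair (w : ℕ) (pts : List (K × K)) (P M N D : K[X]) : Prop where
  fst_mem : Interpolates φ pts P M
  snd_mem : Interpolates φ pts N D
  fst_lead : M.degree + w < P.degree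
  snd_lead : N.degree ≤ D.degree + w
  ne_zero : D ≠ 0

lemma Interpolates.combine {pts : List (K × K)} {P M N D : K[X]} (h₁ : Interpolates φ pts P M)
    (h₂ : Interpolates φ pts N D) (β γ : K[X]) :
    Interpolates φ pts (skewMul φ β P + skewMul φ γ N) (skewMul φ β M + skewMul φ γ D) := by
  intro x hx
  simp only [map_add, value_skewMul]
  rw [add_add_add_comm, ← value_add_point, ← value_add_point, h₁ x hx, h₂ x hx]
  simp

lemma finrank_degreeLT (n : ℕ) : Module.finrank K (degreeLT K n) = n := by
  rw [(degreeLTEquiv K n).finrank_eq, Module.finrank_fin_fun]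

/-- Evaluation at the points of `l` is an injective linear map between spaces of equal dimension. -/
lemma IsIndep.exists_interpolation {l : List K} (h : IsIndep φ l) (v : Fin l.length → K) :
    ∃ p : K[X], ∀ j, value φ (l.get j) p = v j := by
  let T : degreeLT K l.length →ₗ[K] (Fin l.length → K) :=
    (LinearMap.pi fun j => value φ (l.get j)).comp (degreeLT K l.length).subtype
  have hinj : Function.Injective T := by
    rw [injective_iff_map_eq_zero]
    rintro ⟨p, hp⟩ h0
    by_contra hne
    have hp0 : p ≠ 0 := fun h => hne (by simp [h])
    refine absurd (h p hp0 fun x hx => ?_) (not_le.mpr (mem_degreeLT.mp hp))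
    obtain ⟨j, rfl⟩ := List.mem_iff_get.mp hx
    exact congrFun h0 j
  have hsurj := (LinearMap.injective_iff_surjective_of_finrank_eq_finrank
    (by rw [finrank_degreeLT, Module.finrank_fin_fun])).mp hinj
  obtain ⟨p, hp⟩ := hsurj v
  exact ⟨p, fun j => congrFun hp j⟩

section Dimension

variable {w : ℕ} {pts : List (K × K)} {P M N D : K[X]}

variable (φ pts) in
/-- Evaluation at `pts` of the rows with entries of degree below `a` and `b`. -/
noncomputable def evalRows (a b : ℕ) :
    degreeLT K a × degreeLT K b →ₗ[K] (Fin (pts.map Prod.fst).length → K) :=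
  LinearMap.pi fun j =>
    ((value φ (pts.get (j.cast (by simp))).1).comp (degreeLT K a).subtype).coprod
      ((value φ (pts.get (j.cast (by simp))).2).comp (degreeLT K b).subtype)

/-- Every vector of values is attained by some row, and reducing that row modulo elements of the
interpolation module does not change the values. -/
lemma IsReducedPair.evalRows_surjective (h : IsReducedPair φ w pts P M N D)
    (hl : IsIndep φ (pts.map Prod.fst)) :
    Function.Surjective (evalRows φ pts P.natDegree D.natDegree) := by
  intro v
  have hP : P ≠ 0 := by rintro rfl; simpa using h.fst_lead
  obtain ⟨p, hp⟩ := hl.exists_interpolation v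
  obtain ⟨β, γ, s₁, s₂, e₁, e₂, hs₁, hs₂⟩ :=
    exists_reduction (φ := φ) h.fst_lead h.snd_lead h.ne_zero p 0
  rw [degree_eq_natDegree hP] at hs₁
  rw [degree_eq_natDegree h.ne_zero] at hs₂
  refine ⟨(⟨s₁, mem_degreeLT.mpr hs₁⟩, ⟨s₂, mem_degreeLT.mpr hs₂⟩), funext fun j => ?_⟩
  have hc := h.fst_mem.combine h.snd_mem β γ (pts.get (j.cast (by simp))) (List.get_mem _ _)
  have hp' := hp j
  simp only [List.get_eq_getElem, List.getElem_map] at hp'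
  have e₁' := congrArg (value φ (pts.get (j.cast (by simp))).1) e₁
  have e₂' := congrArg (value φ (pts.get (j.cast (by simp))).2) e₂
  rw [map_add] at e₁' e₂'
  simp only [evalRows, LinearMap.pi_apply, LinearMap.coprod_apply, LinearMap.comp_apply,
    Submodule.subtype_apply, ← hp']
  simp only [map_zero, List.get_eq_getElem, Fin.val_cast] at e₁' e₂' hc ⊢
  linear_combination -hc - e₁' - e₂'

/-- The space of reduced rows is mapped onto the space of vectors of values. -/
lemma IsReducedPair.length_le (h : IsReducedPair φ w pts P M N D)
    (hl : IsIndep φ (pts.map Prod.fst)) : pts.length ≤ P.natDegree + D.natDegree := by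
  have := LinearMap.finrank_le_finrank_of_surjective (h.evalRows_surjective hl)
  simpa [Module.finrank_prod, finrank_degreeLT] using this

/-- A reduced pair of minimal total degree generates the interpolation module: the evaluation map is
then injective on reduced rows, so that the remainder of a row of the module is zero. -/
lemma IsReducedPair.exists_combination (h : IsReducedPair φ w pts P M N D)
    (hl : IsIndep φ (pts.map Prod.fst)) (hn : P.natDegree + D.natDegree = pts.length)
    {f₁ f₂ : K[X]} (hf : Interpolates φ pts f₁ f₂) :
    ∃ β γ : K[X], f₁ = skewMul φ β P + skewMul φ γ N ∧ f₂ = skewMul φ β M + skewMul φ γ D := by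
  have hP : P ≠ 0 := by rintro rfl; simpa using h.fst_lead
  have hinj := (LinearMap.injective_iff_surjective_of_finrank_eq_finrank
    (by simpa [Module.finrank_prod, finrank_degreeLT] using hn)).mpr (h.evalRows_surjective hl)
  obtain ⟨β, γ, s₁, s₂, e₁, e₂, hs₁, hs₂⟩ :=
    exists_reduction (φ := φ) h.fst_lead h.snd_lead h.ne_zero f₁ f₂
  rw [degree_eq_natDegree hP] at hs₁
  rw [degree_eq_natDegree h.ne_zero] at hs₂
  have h0 : (⟨⟨s₁, mem_degreeLT.mpr hs₁⟩, ⟨s₂, mem_degreeLT.mpr hs₂⟩⟩ :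
      degreeLT K P.natDegree × degreeLT K D.natDegree) = 0 := by
    apply hinj
    rw [map_zero]
    funext j
    have hc := h.fst_mem.combine h.snd_mem β γ (pts.get (j.cast (by simp))) (List.get_mem _ _)
    have hf' := hf (pts.get (j.cast (by simp))) (List.get_mem _ _)
    have e₁' := congrArg (value φ (pts.get (j.cast (by simp))).1) e₁
    have e₂' := congrArg (value φ (pts.get (j.cast (by simp))).2) e₂
    rw [map_add] at e₁' e₂'
    simp only [evalRows, LinearMap.pi_apply, LinearMap.coprod_apply, LinearMap.comp_apply,
      Submodule.subtype_apply, Pi.zero_apply]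
    linear_combination hf' - hc - e₁' - e₂'
  simp only [Prod.mk_eq_zero, Submodule.mk_eq_zero] at h0
  exact ⟨β, γ, by rw [e₁, h0.1, add_zero], by rw [e₂, h0.2, add_zero]⟩

/-- The predictable leading monomial property: in the expression of a row whose leading position is
the second one, the multiple of the second row dominates. -/
lemma IsReducedPair.degree_combination (h : IsReducedPair φ w pts P M N D) {β γ : K[X]}
    (hne : skewMul φ β M + skewMul φ γ D ≠ 0)
    (hlead : (skewMul φ β P + skewMul φ γ N).degree ≤
      (skewMul φ β M + skewMul φ γ D).degree + w) :
    γ ≠ 0 ∧ (skewMul φ β M + skewMul φ γ D).degree = γ.degree + D.degree ∧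
      β.degree + P.degree ≤ γ.degree + D.degree + w := by
  have hβ : β.degree + P.degree ≤ γ.degree + D.degree + w := by
    by_contra hlt
    rw [not_le] at hlt
    have hb : β.degree ≠ ⊥ := by intro h0; simp [h0] at hlt
    have hN : (skewMul φ γ N).degree < (skewMul φ β P).degree := by
      rw [degree_skewMul, degree_skewMul]
      exact ((add_le_add_right h.snd_lead _).trans_eq (add_assoc _ _ _).symm).trans_lt hlt
    have hM : (skewMul φ β M).degree + w < β.degree + P.degree := by
      rw [degree_skewMul, add_assoc]
      exact WithBot.add_lt_add_left hb h.fst_lead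
    rw [degree_add_eq_left_of_degree_lt hN, degree_skewMul] at hlead
    have hD : (skewMul φ γ D).degree + w < β.degree + P.degree := by rwa [degree_skewMul]
    refine absurd hlead (not_le.mpr ?_)
    rcases le_total (skewMul φ β M).degree (skewMul φ γ D).degree with hle | hle
    · exact (add_le_add_left ((degree_add_le _ _).trans (max_le hle le_rfl)) _).trans_lt hD
    · exact (add_le_add_left ((degree_add_le _ _).trans (max_le le_rfl hle)) _).trans_lt hM
  have hP : P ≠ 0 := by rintro rfl; simpa using h.fst_lead
  have hγ : γ ≠ 0 := by
    rintro rfl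
    have : β = 0 := by
      simp only [degree_zero, WithBot.bot_add, le_bot_iff, WithBot.add_eq_bot, degree_eq_bot,
        hP, or_false] at hβ
      exact hβ
    exact hne (by simp [this])
  refine ⟨hγ, ?_, hβ⟩
  rw [degree_add_eq_right_of_degree_lt, degree_skewMul]
  rw [degree_skewMul, degree_skewMul]
  rcases eq_or_ne β 0 with rfl | hb
  · simpa [bot_lt_iff_ne_bot, hγ] using h.ne_zero
  · exact lt_of_add_lt_of_add_le (degree_ne_bot.mpr hb) h.fst_lead hβ

end Dimension
end Module

/-! ### The Frobenius map and the code -/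

section Frobenius

variable (F K : Type*) [Field F] [Fintype F] [Field K] [Algebra F K]

/-- The Frobenius map `x ↦ x ^ q` with `q = |F|`. -/
def frob : K →+* K := (FiniteField.frobeniusAlgHom F K).toRingHom

variable {F K}

lemma frob_apply (x : K) : frob F K x = x ^ Fintype.card F := rfl

lemma frob_pow_apply (i : ℕ) (x : K) : (frob F K ^ i) x = x ^ (Fintype.card F ^ i) := by
  induction i with
  | zero => simp [RingHom.one_def]
  | succ i ih =>
    rw [pow_succ', RingHom.mul_def, RingHom.comp_apply, ih, frob_apply, ← pow_mul, pow_succ]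

lemma value_smul_point (c : F) (x : K) (p : K[X]) :
    value (frob F K) (c • x) p = c • value (frob F K) x p := by
  induction p using Polynomial.induction_on' with
  | add p p' hp hp' => rw [map_add, map_add, hp, hp', smul_add]
  | monomial i a =>
    have hc : c ^ (Fintype.card F ^ i) = c := FiniteField.pow_card_pow i c
    rw [value_monomial, value_monomial, frob_pow_apply, frob_pow_apply, _root_.smul_pow, hc,
      mul_smul_comm]

/-- The `F`-linear map given by a linearized polynomial. -/
noncomputable def valueLinear (p : K[X]) : K →ₗ[F] K where
  toFun x := value (frob F K) x p
  map_add' x y := value_add_point x y p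
  map_smul' c x := value_smul_point c x p

/-- A nonzero linearized polynomial of `q`-degree `d` is an ordinary polynomial `L` of degree
`q ^ d`, so it cannot vanish on the `q ^ n` linear combinations of `n > d` independent points. -/
lemma isIndep_of_linearIndependent {n : ℕ} {g : Fin n → K} (hg : LinearIndependent F g) :
    IsIndep (frob F K) (List.ofFn g) := by
  intro p hp hv
  rw [List.length_ofFn]
  by_contra hlt
  rw [not_le, degree_eq_natDegree hp, Nat.cast_lt] at hlt
  have hq : 1 < Fintype.card F := Fintype.one_lt_card
  let L : K[X] := ∑ i ∈ Finset.range (p.natDegree + 1),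
    monomial (Fintype.card F ^ i) (p.coeff i)
  have hdeg : L.natDegree ≤ Fintype.card F ^ p.natDegree := by
    refine natDegree_sum_le_of_forall_le _ _ fun i hi => (natDegree_monomial_le _).trans ?_
    exact Nat.pow_le_pow_right hq.le (by simpa [Nat.lt_succ_iff] using hi)
  have heval (x : K) : L.eval x = value (frob F K) x p := by
    conv_rhs => rw [p.as_sum_range, map_sum]
    simp only [L, eval_finsetSum, eval_monomial, value_monomial, frob_pow_apply]
  have hL : L = 0 := by
    refine eq_zero_of_natDegree_lt_card_of_eval_eq_zero L
      (f := fun c : Fin n → F => ∑ j, c j • g j) ?_ ?_ ?_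
    · exact linearIndependent_iff_injective_fintypeLinearCombination.mp hg
    · intro c
      rw [heval]
      change valueLinear (F := F) p (∑ j, c j • g j) = 0
      rw [map_sum]
      refine Finset.sum_eq_zero fun j _ => ?_
      rw [map_smul]
      exact smul_eq_zero_of_right _ (hv _ (by simp [List.mem_ofFn]))
    · rw [Fintype.card_fun, Fintype.card_fin]
      exact hdeg.trans_lt (Nat.pow_lt_pow_right hq hlt)
  have hc : L.coeff (Fintype.card F ^ p.natDegree) = p.leadingCoeff := by
    simp only [L, finsetSum_coeff, coeff_monomial]
    rw [Finset.sum_eq_single p.natDegree]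
    · simp
    · intro i _ hi
      rw [if_neg fun h => hi (Nat.pow_right_injective hq h)]
    · simp
  rw [hL, coeff_zero] at hc
  exact hp (leadingCoeff_eq_zero.mp hc.symm)

/-- A space of dimension `d` over `F` is annihilated by a linearized polynomial of `q`-degree at
most `d`, since this amounts to `d` linear equations for `d + 1` coefficients. -/
lemma exists_annihilator [FiniteDimensional F K] (S : Submodule F K) :
    ∃ D : K[X], D ≠ 0 ∧ D.degree ≤ Module.finrank F S ∧ ∀ x ∈ S, value (frob F K) x D = 0 := by
  set t := Module.finrank F S
  let b := Module.finBasis F S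
  let T : degreeLT K (t + 1) →ₗ[K] (Fin t → K) :=
    (LinearMap.pi fun j => value (frob F K) (b j : K)).comp (degreeLT K (t + 1)).subtype
  have hker : LinearMap.ker T ≠ ⊥ := LinearMap.ker_ne_bot_of_finrank_lt (by
    rw [finrank_degreeLT, Module.finrank_fin_fun]; omega)
  obtain ⟨⟨D, hD⟩, hmem, hne⟩ := Submodule.exists_mem_ne_zero_of_ne_bot hker
  refine ⟨D, fun h => hne (by simp [h]), le_of_lt_succ (mem_degreeLT.mp hD), fun x hx => ?_⟩
  have h0 : (valueLinear (F := F) D).comp S.subtype = 0 :=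
    b.ext fun j => congrFun (LinearMap.mem_ker.mp hmem) j
  exact LinearMap.congr_fun h0 ⟨x, hx⟩

/-- The columns of the coordinate matrix are the coordinate vectors of the entries. -/
lemma rankDist_eq_finrank_span [FiniteDimensional F K] {n : ℕ} (c r : Fin n → K) :
    rankDist F c r = Module.finrank F (Submodule.span F (Set.range (c - r))) := by
  let e := (Module.finBasis F K).equivFun
  have hcols : Set.range (expand F c - expand F r).col = e '' Set.range (c - r) := by
    rw [← Set.range_comp]
    congr 1
    ext j i
    simp [expand, e, Matrix.col]
  rw [rankDist, Matrix.rank_eq_finrank_span_cols, hcols, ← LinearEquiv.coe_coe,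
    ← Submodule.map_span]
  exact LinearEquiv.finrank_map_eq e _

/-- The row of the interpolation module that belongs to a codeword: `D` annihilates the space
spanned by the entries of the error vector, and `μ` is minus the message polynomial. -/
lemma exists_decodable [FiniteDimensional F K] {n k : ℕ} {g c : Fin n → K} (r : Fin n → K)
    (hc : c ∈ code F k g) :
    ∃ D μ : K[X], D ≠ 0 ∧ D.degree ≤ rankDist F c r ∧ μ.degree < k ∧
      ∀ j, value (frob F K) (g j) (skewMul (frob F K) D μ) + value (frob F K) (r j) D = 0 := by
  obtain ⟨a, ha⟩ := (Submodule.mem_span_range_iff_exists_fun K).mp hc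
  obtain ⟨D, hD0, hDdeg, hD⟩ := exists_annihilator (Submodule.span F (Set.range (c - r)))
  refine ⟨D, -∑ i : Fin k, monomial i (a i), hD0,
    by rwa [rankDist_eq_finrank_span], ?_, fun j => ?_⟩
  · rw [degree_neg, ← mem_degreeLT]
    exact Submodule.sum_mem _ fun i _ => mem_degreeLT.mpr
      ((degree_monomial_le _ _).trans_lt (by exact_mod_cast i.2))
  · have hcj : c j = value (frob F K) (g j) (∑ i : Fin k, monomial i (a i)) := by
      rw [← ha, map_sum, Finset.sum_apply]
      simp [mooreMatrix, frob_pow_apply, Matrix.row]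
    have h0 := hD (c j - r j) (Submodule.subset_span ⟨j, rfl⟩)
    rw [sub_eq_add_neg, value_add_point, value_neg_point] at h0
    rw [value_skewMul, map_neg, ← hcj, value_neg_point]
    linear_combination -h0

end Frobenius

/-! ### Counted computations with coefficient lists -/

section Computations

variable {α β σ : Type}

/-- The computation `c` after `n` further operations. A terminating computation is of the form
`delay n (pure a)`. -/
def delay (n : ℕ) (c : Comp α) : Comp α := charge n >>= fun _ => c

lemma delay_bind (n : ℕ) (c : Comp α) (f : α → Comp β) : delay n c >>= f = delay n (c >>= f) := by
  simp [delay]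

lemma delay_apply (n s : ℕ) (c : Comp α) : (delay n c).run s = c.run (s + n) := rfl

lemma delay_delay (n m : ℕ) (c : Comp α) : delay n (delay m c) = delay (n + m) c := by
  funext s
  change (delay n (delay m c)).run s = (delay (n + m) c).run s
  rw [delay_apply, delay_apply, delay_apply, add_assoc]

lemma zero_delay (c : Comp α) : delay 0 c = c := rfl

lemma map_delay (n : ℕ) (f : α → β) (c : Comp α) : f <$> delay n c = delay n (f <$> c) := by
  rw [map_eq_pure_bind, delay_bind, ← map_eq_pure_bind]

lemma op_eq (a : α) : op a = delay 1 (pure a) := rfl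

lemma charge_bind (n : ℕ) (f : Unit → Comp α) : charge n >>= f = delay n (f ()) := rfl

lemma whileLoop_inl {step : σ → Comp (σ ⊕ α)} {s s' : σ} {n : ℕ}
    (h : step s = delay n (pure (Sum.inl s'))) :
    whileLoop step s = delay n (whileLoop step s') := by
  rw [whileLoop, h, delay_bind, pure_bind]

lemma whileLoop_inr {step : σ → Comp (σ ⊕ α)} {s : σ} {a : α} {n : ℕ}
    (h : step s = delay n (pure (Sum.inr a))) : whileLoop step s = delay n (pure a) := by
  rw [whileLoop, h, delay_bind, pure_bind]

lemma mapM_eq {f : α → Comp β} {P : α → β → Prop} {N : ℕ} (l : List α)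
    (h : ∀ x ∈ l, ∃ y n, f x = delay n (pure y) ∧ n ≤ N ∧ P x y) :
    ∃ ys n, l.mapM f = delay n (pure ys) ∧ n ≤ l.length * N ∧ List.Forall₂ P l ys := by
  induction l with
  | nil => exact ⟨[], 0, by rw [List.mapM_nil, zero_delay], by simp, .nil⟩
  | cons x l ih =>
    obtain ⟨y, n, e, hn, hy⟩ := h x (by simp)
    obtain ⟨ys, n', e', hn', hys⟩ := ih fun x hx => h x (by simp [hx])
    refine ⟨y :: ys, n + n', ?_, ?_, .cons hy hys⟩
    · simp only [List.mapM_cons, e, e', delay_bind, pure_bind, delay_delay]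
    · rw [List.length_cons, Nat.succ_mul]
      omega

end Computations

section Lists

variable {K : Type} [Field K]

/-- The encoding polynomial `∑ aᵢ Xⁱ` of the coefficient list `[a₀, a₁, …]`. -/
noncomputable def toPoly : List K → K[X]
  | [] => 0
  | a :: f => C a + X * toPoly f

@[simp] lemma toPoly_nil : toPoly ([] : List K) = 0 := rfl

@[simp] lemma toPoly_cons (a : K) (f : List K) : toPoly (a :: f) = C a + X * toPoly f := rfl

lemma toPoly_append (f g : List K) : toPoly (f ++ g) = toPoly f + X ^ f.length * toPoly g := by
  induction f with
  | nil => simp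
  | cons a f ih => simp [ih, pow_succ]; ring

@[simp] lemma toPoly_replicate_zero (d : ℕ) : toPoly (List.replicate d (0 : K)) = 0 := by
  induction d with
  | zero => rfl
  | succ d ih => simp [List.replicate_succ, ih]

lemma degree_toPoly_lt (f : List K) : (toPoly f).degree < f.length := by
  rw [← mem_degreeLT]
  induction f with
  | nil => simp
  | cons a f ih =>
    rw [mem_degreeLT, degree_lt_iff_coeff_zero] at *
    intro m hm
    obtain ⟨m, rfl⟩ : ∃ m', m = m' + 1 := ⟨m - 1, by simp at hm; omega⟩
    simp only [List.length_cons, add_le_add_iff_right] at hm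
    simp [coeff_X_mul, ih m hm]

lemma exists_toPoly_eq {p : K[X]} {d : ℕ} (h : p.degree < d) :
    ∃ f : List K, f.length = d ∧ toPoly f = p := by
  induction d generalizing p with
  | zero =>
    refine ⟨[], rfl, ?_⟩
    have : p = 0 := by simpa using h
    rw [this, toPoly_nil]
  | succ d ih =>
    obtain ⟨f, hf, e⟩ := ih (p := p.divX) (by
      rw [degree_lt_iff_coeff_zero] at *
      intro m hm
      rw [coeff_divX]
      exact h _ (by omega))
    exact ⟨p.coeff 0 :: f, by simp [hf], by rw [toPoly_cons, e, add_comm, X_mul_divX_add]⟩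

lemma toPoly_eq_dropLast_add (f : List K) :
    toPoly f = toPoly f.dropLast + X ^ (f.length - 1) * C (f.getLastD 0) := by
  rcases List.eq_nil_or_concat f with rfl | ⟨g, a, rfl⟩
  · simp
  · simp [toPoly_append]

lemma coeff_toPoly_length_sub_one (f : List K) :
    (toPoly f).coeff (f.length - 1) = f.getLastD 0 := by
  rw [toPoly_eq_dropLast_add, coeff_add, coeff_X_pow_mul', if_pos le_rfl, Nat.sub_self,
    coeff_C_zero, coeff_eq_zero_of_degree_lt, zero_add]
  simpa using degree_toPoly_lt f.dropLast

lemma toPoly_dropLast {f : List K} (h : (toPoly f).coeff (f.length - 1) = 0) :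
    toPoly f.dropLast = toPoly f := by
  rw [coeff_toPoly_length_sub_one] at h
  rw [toPoly_eq_dropLast_add f, h]
  simp

/-- The list has no leading zero coefficients: its length gives the degree of the polynomial. -/
def Trimmed (f : List K) : Prop := qdeg f = (toPoly f).degree

lemma trimmed_nil : Trimmed ([] : List K) := by simp [Trimmed, qdeg]

lemma Trimmed.eq_nil {f : List K} (h : Trimmed f) (h0 : toPoly f = 0) : f = [] := by
  rw [Trimmed, h0, degree_zero] at h
  cases f with
  | nil => rfl
  | cons a f => simp [qdeg] at h

lemma Trimmed.toPoly_ne_zero {f : List K} (h : Trimmed f) (h0 : f ≠ []) : toPoly f ≠ 0 :=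
  fun e => h0 (h.eq_nil e)

lemma Trimmed.length_eq {f : List K} (h : Trimmed f) (h0 : toPoly f ≠ 0) :
    f.length = (toPoly f).natDegree + 1 := by
  cases f with
  | nil => simp at h0
  | cons a f =>
    rw [Trimmed, degree_eq_natDegree h0] at h
    simp only [qdeg, List.length_cons] at *
    norm_cast at h
    omega

lemma Trimmed.length_le {f : List K} (h : Trimmed f) {d : ℕ} (hd : (toPoly f).degree < d) :
    f.length ≤ d := by
  by_cases h0 : toPoly f = 0
  · simp [h.eq_nil h0]
  · rw [degree_eq_natDegree h0, Nat.cast_lt] at hd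
    rw [h.length_eq h0]
    omega

lemma Trimmed.getLastD_ne_zero {f : List K} (h : Trimmed f) (h0 : f ≠ []) : f.getLastD 0 ≠ 0 := by
  have h1 := h.toPoly_ne_zero h0
  rw [← coeff_toPoly_length_sub_one, h.length_eq h1]
  simpa using h1

lemma trimmed_singleton_one : Trimmed [(1 : K)] := by simp [Trimmed, qdeg]

end Lists

section Programs

variable {K : Type} [Field K]

lemma trim_eq [DecidableEq K] (f : List K) :
    ∃ h n, trim f = delay n (pure h) ∧ n ≤ f.length ∧ Trimmed h ∧ toPoly h = toPoly f ∧
      h.length ≤ f.length := by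
  induction f with
  | nil => exact ⟨[], 0, by rw [trim, zero_delay], by simp, trimmed_nil, rfl, le_rfl⟩
  | cons a f ih =>
    obtain ⟨h, n, e, hn, ht, hp, hl⟩ := ih
    cases h with
    | nil =>
      have hf : toPoly f = 0 := hp.symm
      by_cases ha : a = 0
      · refine ⟨[], n + 1, ?_, by simpa using hn, trimmed_nil, by simp [hf, ha], by simp⟩
        simp [trim, e, delay_bind, map_delay, isZeroE, op_eq, delay_delay, ha]
      · refine ⟨[a], n + 1, ?_, by simpa using hn, ?_, by simp [hf], by simp⟩
        · simp [trim, e, delay_bind, map_delay, isZeroE, op_eq, delay_delay, ha]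
        · simp [Trimmed, qdeg, degree_C ha]
    | cons b h =>
      refine ⟨a :: b :: h, n, ?_, by simp; omega, ?_, by rw [toPoly_cons, hp, toPoly_cons], by
        simpa using hl⟩
      · simp [trim, e, delay_bind]
      · have h0 := ht.toPoly_ne_zero (by simp)
        have hlen := ht.length_eq h0
        rw [Trimmed, toPoly_cons a, add_comm, degree_add_C, degree_mul, degree_X,
          degree_eq_natDegree h0]
        · simp only [qdeg, hlen]
          push_cast
          rw [add_comm]
        · rw [degree_mul, degree_X, degree_eq_natDegree h0]
          norm_cast
          omega

lemma addP_eq (f g : List K) :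
    ∃ h n, addP f g = delay n (pure h) ∧ n ≤ f.length ∧ toPoly h = toPoly f + toPoly g ∧
      h.length ≤ max f.length g.length := by
  induction f generalizing g with
  | nil => exact ⟨g, 0, by rw [addP, zero_delay], by simp, by simp, by simp⟩
  | cons a f ih =>
    cases g with
    | nil => exact ⟨a :: f, 0, by rw [addP, zero_delay], by simp, by simp, by simp⟩
    | cons b g =>
      obtain ⟨h, n, e, hn, hp, hl⟩ := ih g
      refine ⟨(a + b) :: h, 1 + n, ?_, by simp; omega, ?_, by simp; omega⟩
      · simp [addP, addE, op_eq, e, delay_bind, map_delay, delay_delay]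
      · simp [hp]; ring

lemma subP_eq (f g : List K) :
    ∃ h n, subP f g = delay n (pure h) ∧ n ≤ g.length ∧ toPoly h = toPoly f - toPoly g ∧
      h.length = max f.length g.length := by
  induction f generalizing g with
  | nil =>
    induction g with
    | nil => exact ⟨[], 0, by rw [subP, zero_delay], by simp, by simp, by simp⟩
    | cons b g ih =>
      obtain ⟨h, n, e, hn, hp, hl⟩ := ih
      refine ⟨(0 - b) :: h, 1 + n, ?_, by simp; omega, ?_, by simp at hl ⊢; omega⟩
      · simp [subP, subE, op_eq, e, delay_bind, map_delay, delay_delay]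
      · simp [hp]; ring
  | cons a f ih =>
    cases g with
    | nil => exact ⟨a :: f, 0, by rw [subP, zero_delay], by simp, by simp, by simp⟩
    | cons b g =>
      obtain ⟨h, n, e, hn, hp, hl⟩ := ih g
      refine ⟨(a - b) :: h, 1 + n, ?_, by simp; omega, ?_, by simp; omega⟩
      · simp [subP, subE, op_eq, e, delay_bind, map_delay, delay_delay]
      · simp [hp]; ring

lemma smulP_eq (c : K) (f : List K) :
    ∃ h, smulP c f = delay f.length (pure h) ∧ toPoly h = C c * toPoly f ∧
      h.length = f.length := by
  induction f with
  | nil => exact ⟨[], rfl, by simp, rfl⟩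
  | cons a f ih =>
    obtain ⟨h, e, hp, hl⟩ := ih
    rw [smulP] at e
    refine ⟨c * a :: h, ?_, by simp [hp]; ring, by simp [hl]⟩
    simp [smulP, mulE, op_eq] at e ⊢
    simp [e, delay_bind, map_delay, delay_delay, add_comm]

variable {F : Type} [Field F] [Fintype F] [Algebra F K]

local notation "q" => Fintype.card F
local notation "φ" => frob F K

variable (F)

lemma frobP_eq (i : ℕ) (f : List K) :
    ∃ h, frobP q i f = delay f.length (pure h) ∧ toPoly h = (toPoly f).map (φ ^ i) ∧
      h.length = f.length := by
  induction f with
  | nil => exact ⟨[], rfl, by simp, rfl⟩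
  | cons a f ih =>
    obtain ⟨h, e, hp, hl⟩ := ih
    rw [frobP] at e
    refine ⟨a ^ (q ^ i) :: h, ?_, ?_, by simp [hl]⟩
    · simp [frobP, frobE, op_eq] at e ⊢
      simp [e, delay_bind, map_delay, delay_delay, add_comm]
    · rw [toPoly_cons, toPoly_cons, Polynomial.map_add, Polynomial.map_mul, map_C, map_X, hp,
        frob_pow_apply]

lemma evalP_eq (f : List K) (x : K) :
    evalP q f x = delay (3 * f.length) (pure (value φ x (toPoly f))) := by
  induction f generalizing x with
  | nil => simp [evalP, zero_delay]
  | cons a f ih =>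
    simp only [evalP, mulE, frobE, addE, op_eq, ih, delay_bind, pure_bind, delay_delay]
    rw [toPoly_cons, map_add, value_C, value_X_mul, frob_apply, pow_one, List.length_cons]
    congr 1
    ring

lemma compAux_eq (f g : List K) :
    ∃ h n, compAux q f g = delay n (pure h) ∧ n ≤ 3 * f.length * g.length ∧
      toPoly h = skewMul φ (toPoly f) (toPoly g) ∧ h.length ≤ f.length + (g.length - 1) := by
  induction f generalizing g with
  | nil => exact ⟨[], 0, by rw [compAux, zero_delay], by simp, by simp, by simp⟩
  | cons a f ih =>
    obtain ⟨h₁, e₁, p₁, l₁⟩ := smulP_eq a g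
    obtain ⟨h₂, e₂, p₂, l₂⟩ := frobP_eq F 1 g
    obtain ⟨h₃, n₃, e₃, c₃, p₃, l₃⟩ := ih h₂
    obtain ⟨h₄, n₄, e₄, c₄, p₄, l₄⟩ := addP_eq h₁ (0 :: h₃)
    refine ⟨h₄, _, by
      simp only [compAux, e₁, e₂, e₃, e₄, delay_bind, pure_bind, delay_delay]; rfl, ?_, ?_, ?_⟩
    · rw [List.length_cons]
      rw [l₂] at c₃
      nlinarith
    · rw [p₄, p₁, toPoly_cons, toPoly_cons, p₃, p₂, pow_one, skewMul_add_left, skewMul_C_left,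
        skewMul_X_mul]
      simp
    · simp at l₄ ⊢
      omega

lemma compP_eq [DecidableEq K] (f g : List K) :
    ∃ h n, compP q f g = delay n (pure h) ∧ n ≤ 3 * f.length * g.length + f.length + g.length ∧
      Trimmed h ∧ toPoly h = skewMul φ (toPoly f) (toPoly g) ∧
      h.length ≤ f.length + (g.length - 1) := by
  obtain ⟨h₁, n₁, e₁, c₁, p₁, l₁⟩ := compAux_eq F f g
  obtain ⟨h₂, n₂, e₂, c₂, t₂, p₂, l₂⟩ := trim_eq h₁
  exact ⟨h₂, _, by simp only [compP, e₁, e₂, delay_bind, pure_bind, delay_delay]; rfl,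
    by omega, t₂, p₂.trans p₁, by omega⟩

end Programs

/-! ### Symbolic division -/

section Programs

variable {K : Type} [Field K]

lemma skewMul_X_left {φ : K →+* K} (f : K[X]) : skewMul φ X f = X * f.map φ := by
  rw [← mul_one X, skewMul_X_mul, skewMul_one_left, mul_one]

lemma skewMul_mul_X_pow {φ : K →+* K} (f g : K[X]) (d : ℕ) :
    skewMul φ f (X ^ d * g) = X ^ d * skewMul φ f g := by
  induction f using Polynomial.induction_on' with
  | add p p' hp hp' => rw [skewMul_add_left, hp, hp', skewMul_add_left, mul_add]
  | monomial n a =>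
    rw [skewMul_monomial, skewMul_monomial, Polynomial.map_mul, Polynomial.map_pow, map_X]
    ring

lemma coeff_skewMul_C {φ : K →+* K} (f : K[X]) (c : K) (i : ℕ) :
    (skewMul φ f (C c)).coeff i = f.coeff i * (φ ^ i) c := by
  induction f using Polynomial.induction_on' with
  | add p p' hp hp' => rw [skewMul_add_left, coeff_add, hp, hp', coeff_add, add_mul]
  | monomial n a =>
    rw [skewMul_monomial, map_C, mul_left_comm, ← C_mul, coeff_X_pow_mul', coeff_monomial]
    rcases lt_trichotomy n i with h | rfl | h
    · rw [if_pos h.le, if_neg h.ne, coeff_C, if_neg (by omega), zero_mul]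
    · simp
    · rw [if_neg (by omega), if_neg h.ne', zero_mul]

variable {F : Type} [Field F] [Fintype F] [Algebra F K]

local notation "q" => Fintype.card F
local notation "φ" => frob F K

variable (F)

/-- Each step cancels the leading coefficient of `f`, which may be zero: the length of `f`, not its
degree, drops by one. -/
lemma divRightAux_eq {g : List K} (hg : g.getLastD 0 ≠ 0) (hg0 : g ≠ []) (d : ℕ) (f : List K)
    (hd : f.length + 1 - g.length = d) :
    ∃ p r n, divRightAux q g d f = delay n (pure (p, r)) ∧
      n ≤ d * (2 + 2 * g.length + f.length) ∧
      toPoly f = skewMul φ (toPoly p) (toPoly g) + toPoly r ∧ p.length = d ∧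
      r.length < g.length := by
  have hpos := List.length_pos_of_ne_nil hg0
  induction d generalizing f with
  | zero =>
    exact ⟨[], f, 0, by rw [divRightAux, zero_delay], by simp, by simp, rfl, by omega⟩
  | succ d ih =>
    have hb : (φ ^ d) (g.getLastD 0) ≠ 0 := (_root_.map_ne_zero _).mpr hg
    set c := f.getLastD 0 / (φ ^ d) (g.getLastD 0) with hc
    obtain ⟨h₁, e₁, p₁, l₁⟩ := frobP_eq F d g
    obtain ⟨h₂, e₂, p₂, l₂⟩ := smulP_eq c h₁
    obtain ⟨h₃, n₃, e₃, c₃, p₃, l₃⟩ := subP_eq f (List.replicate d 0 ++ h₂)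
    have hlen : h₃.length = f.length := by simp at l₃; omega
    have hX : toPoly (List.replicate d 0 ++ h₂) = skewMul φ (monomial d c) (toPoly g) := by
      rw [toPoly_append, p₂, p₁, skewMul_monomial, toPoly_replicate_zero, List.length_replicate]
      ring
    have htop : (toPoly h₃).coeff (h₃.length - 1) = 0 := by
      have hm : d ≤ f.length - 1 := by omega
      have hm' : f.length - 1 - d = g.length - 1 := by omega
      rw [hlen, p₃, hX, coeff_sub, skewMul_monomial, coeff_C_mul, coeff_X_pow_mul', if_pos hm, hm',
        coeff_map, coeff_toPoly_length_sub_one, coeff_toPoly_length_sub_one, hc,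
        div_mul_cancel₀ _ hb, sub_self]
    obtain ⟨p, r, n, e, cn, hp, lp, lr⟩ := ih h₃.dropLast (by
      rw [List.length_dropLast, hlen]; omega)
    refine ⟨p ++ [c], r, _, by
      simp only [divRightAux, frobE, divE, op_eq, delay_bind, pure_bind, delay_delay]
      rw [← frob_pow_apply, ← hc]
      simp only [e₁, e₂, e₃, e, delay_bind, pure_bind, delay_delay]; rfl, ?_, ?_, by simp [lp], lr⟩
    · rw [List.length_dropLast, hlen] at cn
      simp only [List.length_append, List.length_replicate, l₂, l₁] at c₃
      have : d * (2 + 2 * g.length + (f.length - 1)) ≤ d * (2 + 2 * g.length + f.length) :=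
        Nat.mul_le_mul_left _ (by omega)
      rw [Nat.succ_mul]
      omega
    · rw [toPoly_dropLast htop, p₃, hX] at hp
      rw [toPoly_append, skewMul_add_left, lp, toPoly_cons, toPoly_nil, mul_zero, add_zero,
        mul_comm (X ^ d), C_mul_X_pow_eq_monomial]
      linear_combination hp

lemma divRight_eq [DecidableEq K] {f g : List K} (hg : Trimmed g) (hg0 : g ≠ []) :
    ∃ p r n, divRight q f g = delay n (pure (p, r)) ∧
      n ≤ (f.length + 1 - g.length) * (3 + 2 * g.length + f.length) + g.length ∧
      toPoly f = skewMul φ (toPoly p) (toPoly g) + toPoly r ∧ Trimmed r ∧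
      p.length ≤ f.length + 1 - g.length ∧ r.length < g.length := by
  obtain ⟨p₁, r₁, n₁, e₁, c₁, h₁, lp₁, lr₁⟩ :=
    divRightAux_eq F (hg.getLastD_ne_zero hg0) hg0 _ f rfl
  obtain ⟨p, n₂, e₂, c₂, t₂, h₂, l₂⟩ := trim_eq p₁
  obtain ⟨r, n₃, e₃, c₃, t₃, h₃, l₃⟩ := trim_eq r₁
  refine ⟨p, r, _, by simp only [divRight, e₁, e₂, e₃, delay_bind, pure_bind, delay_delay]; rfl, ?_,
    by rw [h₂, h₃, h₁], t₃, by omega, by omega⟩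
  rw [show 3 + 2 * g.length + f.length = (2 + 2 * g.length + f.length) + 1 by ring, Nat.mul_succ]
  omega

variable [Fintype K]

/-- The root that is extracted in left division, from `a ^ (q ^ m) = a`. -/
lemma frob_pow_frob_pow (a : K) (e : ℕ) :
    (φ ^ e) (a ^ (q ^ ((Module.finrank F K - 1) * e))) = a := by
  have hm : 0 < Module.finrank F K := Module.finrank_pos
  rw [frob_pow_apply, ← pow_mul, ← pow_add]
  have h1 : (Module.finrank F K - 1) * e + e = Module.finrank F K * e := by
    rw [← Nat.succ_mul]; congr 1; omega
  rw [h1, pow_mul, ← Module.card_eq_pow_finrank (K := F) (V := K)]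
  exact FiniteField.pow_card_pow e a

lemma divLeftAux_eq {g : List K} (hg : g.getLastD 0 ≠ 0) (hg0 : g ≠ []) (d : ℕ) (f : List K)
    (hd : f.length + 1 - g.length = d) :
    ∃ p r n, divLeftAux q (Module.finrank F K) g d f = delay n (pure (p, r)) ∧
      n ≤ d * (2 + 3 * g.length + f.length) ∧
      toPoly f = skewMul φ (toPoly g) (toPoly p) + toPoly r ∧ p.length = d ∧
      r.length < g.length := by
  have hpos := List.length_pos_of_ne_nil hg0
  induction d generalizing f with
  | zero =>
    exact ⟨[], f, 0, by rw [divLeftAux, zero_delay], by simp, by simp, rfl, by omega⟩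
  | succ d ih =>
    set a := f.getLastD 0 / g.getLastD 0 with ha
    set c := a ^ (q ^ ((Module.finrank F K - 1) * (g.length - 1))) with hc
    have hφc : (φ ^ (g.length - 1)) c = a := frob_pow_frob_pow F a _
    obtain ⟨h₂, n₂, e₂, c₂, p₂, l₂⟩ := compAux_eq F g [c]
    obtain ⟨h₃, n₃, e₃, c₃, p₃, l₃⟩ := subP_eq f (List.replicate d 0 ++ h₂)
    have hlen : h₃.length = f.length := by simp at l₃ l₂; omega
    have hX : toPoly (List.replicate d 0 ++ h₂) = X ^ d * skewMul φ (toPoly g) (C c) := by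
      rw [toPoly_append, p₂, toPoly_replicate_zero, List.length_replicate]
      simp
    have htop : (toPoly h₃).coeff (h₃.length - 1) = 0 := by
      have hm : d ≤ f.length - 1 := by omega
      have hm' : f.length - 1 - d = g.length - 1 := by omega
      rw [hlen, p₃, hX, coeff_sub, coeff_X_pow_mul', if_pos hm, hm', coeff_skewMul_C, hφc,
        coeff_toPoly_length_sub_one, coeff_toPoly_length_sub_one, ha, mul_div_cancel₀ _ hg,
        sub_self]
    obtain ⟨p, r, n, e, cn, hp, lp, lr⟩ := ih h₃.dropLast (by
      rw [List.length_dropLast, hlen]; omega)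
    refine ⟨p ++ [c], r, _, by
      simp only [divLeftAux, frobE, divE, op_eq, delay_bind, pure_bind, delay_delay]
      rw [← ha, ← hc]
      simp only [e₂, e₃, e, delay_bind, pure_bind, delay_delay]; rfl, ?_, ?_, by simp [lp], lr⟩
    · rw [List.length_dropLast, hlen] at cn
      simp only [List.length_append, List.length_replicate] at c₃
      simp only [List.length_singleton] at c₂ l₂
      have : d * (2 + 3 * g.length + (f.length - 1)) ≤ d * (2 + 3 * g.length + f.length) :=
        Nat.mul_le_mul_left _ (by omega)
      rw [Nat.succ_mul]
      omega
    · rw [toPoly_dropLast htop, p₃, hX] at hp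
      rw [toPoly_append, skewMul_add_right, lp, toPoly_cons, toPoly_nil, mul_zero, add_zero,
        skewMul_mul_X_pow]
      linear_combination hp

/-- Left division succeeds whenever a quotient exists, since the remainder of an exact division has
to vanish for reasons of degree. -/
lemma quotientLeft_eq [DecidableEq K] {f g : List K} {T : ℕ} (hf : Trimmed f) (hg : Trimmed g)
    (hfT : f.length ≤ T) (hgT : g.length ≤ T) :
    ∃ o n, quotientLeft q (Module.finrank F K) f g = delay n (pure o) ∧ n ≤ 8 * T ^ 2 ∧
      ((∃ μ, toPoly f = skewMul φ (toPoly g) μ) → o.isSome) := by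
  by_cases hg0 : g = []
  · subst hg0
    by_cases hf0 : f = []
    · exact ⟨some [], 0, by simp [quotientLeft, hf0, zero_delay], by simp, by simp⟩
    · refine ⟨none, 0, by simp [quotientLeft, hf0, zero_delay], by simp, ?_⟩
      rintro ⟨μ, hμ⟩
      exact absurd (hf.eq_nil (by simpa using hμ)) hf0
  · have hpos := List.length_pos_of_ne_nil hg0
    obtain ⟨p₁, r₁, n₁, e₁, c₁, h₁, lp₁, lr₁⟩ :=
      divLeftAux_eq F (hg.getLastD_ne_zero hg0) hg0 _ f rfl
    obtain ⟨p, n₂, e₂, c₂, t₂, h₂, l₂⟩ := trim_eq p₁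
    obtain ⟨r, n₃, e₃, c₃, t₃, h₃, l₃⟩ := trim_eq r₁
    refine ⟨if r = [] then some p else none, _, by
      simp only [quotientLeft, if_neg hg0, e₁, e₂, e₃, delay_bind, pure_bind, delay_delay]; rfl,
      ?_, ?_⟩
    · have hle : f.length + 1 - g.length ≤ T := by omega
      have : n₁ ≤ T * (2 + 3 * T + T) := c₁.trans (Nat.mul_le_mul hle (by omega))
      have hT : 1 ≤ T := by omega
      nlinarith
    · rintro ⟨μ, hμ⟩
      have hr : toPoly r = skewMul φ (toPoly g) (μ - toPoly p) := by
        rw [skewMul_sub_right, h₂, h₃]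
        linear_combination hμ - h₁
      have hr0 : toPoly r = 0 := by
        by_contra hne
        have h5 := degree_toPoly_lt r
        rw [hr, degree_skewMul, ← hg] at h5
        rw [hr] at hne
        have hμp : μ - toPoly p ≠ 0 := by intro h0; simp [h0] at hne
        rw [degree_eq_natDegree hμp] at h5
        cases g with
        | nil => exact hg0 rfl
        | cons b g =>
          simp only [qdeg] at h5
          norm_cast at h5
          simp only [List.length_cons] at lr₁
          omega
      simp [t₃.eq_nil hr0]

end Programs

section Steps

variable {K : Type} [Field K] [DecidableEq K] (F : Type) [Field F] [Fintype F] [Algebra F K]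

local notation "q" => Fintype.card F
local notation "φ" => frob F K

lemma annihilateP_eq (u : K) (f : List K) :
    ∃ h n, annihilateP q u f = delay n (pure h) ∧ n ≤ 4 * f.length + 3 ∧ Trimmed h ∧
      toPoly h = skewMul φ (X - C (φ u / u)) (toPoly f) := by
  obtain ⟨h₁, e₁, p₁, l₁⟩ := frobP_eq F 1 f
  obtain ⟨h₂, e₂, p₂, l₂⟩ := smulP_eq (φ u / u) f
  obtain ⟨h₃, n₃, e₃, c₃, p₃, l₃⟩ := subP_eq (0 :: h₁) h₂
  obtain ⟨h₄, n₄, e₄, c₄, t₄, p₄, l₄⟩ := trim_eq h₃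
  refine ⟨h₄, _, by
    simp only [annihilateP, frobE, divE, op_eq, pow_one, delay_bind, pure_bind, delay_delay]
    rw [← frob_apply]
    simp only [e₁, e₂, e₃, e₄, delay_bind, pure_bind, delay_delay]; rfl, ?_, t₄, ?_⟩
  · simp at l₃
    omega
  · rw [p₄, p₃, toPoly_cons, p₂, p₁, skewMul_sub_left, skewMul_X_left, skewMul_C_left, pow_one]
    simp

omit [Fintype F] [Algebra F K] [Field F] in
lemma combineP_eq (a b : K) (f g : List K) :
    ∃ h n, combineP a b f g = delay n (pure h) ∧ n ≤ 2 * f.length + 3 * g.length ∧ Trimmed h ∧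
      toPoly h = C a * toPoly f - C b * toPoly g := by
  obtain ⟨h₁, e₁, p₁, l₁⟩ := smulP_eq a f
  obtain ⟨h₂, e₂, p₂, l₂⟩ := smulP_eq b g
  obtain ⟨h₃, n₃, e₃, c₃, p₃, l₃⟩ := subP_eq h₁ h₂
  obtain ⟨h₄, n₄, e₄, c₄, t₄, p₄, l₄⟩ := trim_eq h₃
  exact ⟨h₄, _, by
    simp only [combineP, e₁, e₂, e₃, e₄, delay_bind, pure_bind, delay_delay]; rfl,
    by omega, t₄, by rw [p₄, p₃, p₁, p₂]⟩

end Steps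

/-! ### Annihilator and Lagrange polynomials, and the iterative algorithm -/

section Module

variable {K : Type*} [Field K] {φ : K →+* K} {w : ℕ} {pts : List (K × K)} {x : K × K}
  {P M N D f₁ f₂ : K[X]}

lemma Interpolates.append_singleton (h : Interpolates φ pts f₁ f₂)
    (hx : value φ x.1 f₁ + value φ x.2 f₂ = 0) : Interpolates φ (pts ++ [x]) f₁ f₂ := by
  intro y hy
  rcases List.mem_append.mp hy with hy | hy
  · exact h y hy
  · rwa [List.mem_singleton.mp hy]

lemma Interpolates.linear_combination (h₁ : Interpolates φ pts P M) (h₂ : Interpolates φ pts N D)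
    {c d : K} (hc : value φ x.1 P + value φ x.2 M = c) (hd : value φ x.1 N + value φ x.2 D = d) :
    Interpolates φ (pts ++ [x]) (C d * P - C c * N) (C d * M - C c * D) := by
  refine Interpolates.append_singleton (fun y hy => ?_) ?_ <;>
    simp only [map_sub, value_C_mul]
  · linear_combination d * h₁ y hy - c * h₂ y hy
  · linear_combination d * hc - c * hd

lemma value_X_sub_C (c e : K) : value φ c (X - C e) = φ c - e * c := by
  rw [map_sub, value_C, ← mul_one X, value_X_mul, ← C_1, value_C, one_mul]

lemma Interpolates.annihilate (h : Interpolates φ pts P M) {c : K}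
    (hc : value φ x.1 P + value φ x.2 M = c) :
    Interpolates φ (pts ++ [x]) (skewMul φ (X - C (φ c / c)) P)
      (skewMul φ (X - C (φ c / c)) M) := by
  refine Interpolates.append_singleton (fun y hy => ?_) ?_ <;>
    rw [value_skewMul, value_skewMul, ← value_add_point]
  · rw [h y hy, value_zero_point]
  · rw [hc, value_X_sub_C]
    by_cases h0 : c = 0
    · simp [h0]
    · rw [div_mul_cancel₀ _ h0, sub_self]

/-- Not both rows of a reduced pair of minimal total degree interpolate at a further point. -/
lemma IsReducedPair.not_both_zero (h : IsReducedPair φ w pts P M N D)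
    (hn : P.natDegree + D.natDegree = pts.length) (hl : IsIndep φ ((pts ++ [x]).map Prod.fst))
    (hc : value φ x.1 P + value φ x.2 M = 0) : value φ x.1 N + value φ x.2 D ≠ 0 := by
  intro hd
  have h' : IsReducedPair φ w (pts ++ [x]) P M N D :=
    ⟨h.fst_mem.append_singleton hc, h.snd_mem.append_singleton hd, h.fst_lead, h.snd_lead,
      h.ne_zero⟩
  have := h'.length_le hl
  simp at this
  omega

lemma degree_C_mul_le (a : K) (f : K[X]) : (C a * f).degree ≤ f.degree := by
  rw [← smul_eq_C_mul]
  exact degree_smul_le a f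

lemma degree_C_mul_sub_le (a b : K) (f g : K[X]) {d : WithBot ℕ} (hf : a = 0 ∨ f.degree ≤ d)
    (hg : b = 0 ∨ g.degree ≤ d) : (C a * f - C b * g).degree ≤ d := by
  refine (degree_sub_le _ _).trans (max_le ?_ ?_)
  · rcases hf with rfl | hf
    · simp
    · exact (degree_C_mul_le _ _).trans hf
  · rcases hg with rfl | hg
    · simp
    · exact (degree_C_mul_le _ _).trans hg

lemma degree_C_mul_sub_eq (a : K) {b : K} (hb : b ≠ 0) (f g : K[X]) (hg0 : g ≠ 0)
    (h : a = 0 ∨ f.degree < g.degree) : (C a * f - C b * g).degree = g.degree := by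
  rw [degree_sub_eq_right_of_degree_lt, degree_C_mul hb]
  rw [degree_C_mul hb]
  rcases h with rfl | h
  · simpa [bot_lt_iff_ne_bot] using hg0
  · exact (degree_C_mul_le _ _).trans_lt h

lemma natDegree_skewMul_X_sub_C (e : K) {f : K[X]} (hf : f ≠ 0) :
    (skewMul φ (X - C e) f).natDegree = f.natDegree + 1 := by
  apply natDegree_eq_of_degree_eq_some
  rw [degree_skewMul, degree_X_sub_C, degree_eq_natDegree hf, add_comm]
  rfl

lemma IsReducedPair.fst_ne_zero (h : IsReducedPair φ w pts P M N D) : P ≠ 0 := by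
  rintro rfl
  simpa using h.fst_lead

lemma withBot_one_add_add_lt {a b : WithBot ℕ} (h : a + w < b) : 1 + a + w < 1 + b := by
  rw [add_assoc]
  exact WithBot.add_lt_add_left (by decide) h

/-- The round of the iterative algorithm that raises the degree of the first row. -/
lemma IsReducedPair.step_fst (h : IsReducedPair φ w pts P M N D) {c d : K}
    (hc : value φ x.1 P + value φ x.2 M = c) (hd : value φ x.1 N + value φ x.2 D = d)
    (hc0 : c ≠ 0) (hdeg : d = 0 ∨ P.degree ≤ D.degree + w) :
    IsReducedPair φ w (pts ++ [x]) (skewMul φ (X - C (φ c / c)) P)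
      (skewMul φ (X - C (φ c / c)) M) (C d * P - C c * N) (C d * M - C c * D) ∧
    (skewMul φ (X - C (φ c / c)) P).natDegree = P.natDegree + 1 ∧
    (C d * M - C c * D).natDegree = D.natDegree := by
  have hD : (C d * M - C c * D).degree = D.degree := by
    refine degree_C_mul_sub_eq d hc0 M D h.ne_zero (hdeg.imp_right fun hle => ?_)
    exact lt_of_add_lt_add_right (h.fst_lead.trans_le hle)
  refine ⟨⟨h.fst_mem.annihilate hc, h.fst_mem.linear_combination h.snd_mem hc hd, ?_, ?_, ?_⟩,
    natDegree_skewMul_X_sub_C _ h.fst_ne_zero, natDegree_eq_of_degree_eq hD⟩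
  · rw [degree_skewMul, degree_skewMul, degree_X_sub_C]
    exact withBot_one_add_add_lt h.fst_lead
  · rw [hD]
    exact degree_C_mul_sub_le _ _ _ _ hdeg (Or.inr h.snd_lead)
  · rw [← degree_ne_bot, hD, degree_ne_bot]
    exact h.ne_zero

/-- The round of the iterative algorithm that raises the degree of the second row. -/
lemma IsReducedPair.step_snd (h : IsReducedPair φ w pts P M N D) {c d : K}
    (hc : value φ x.1 P + value φ x.2 M = c) (hd : value φ x.1 N + value φ x.2 D = d)
    (hd0 : d ≠ 0) (hdeg : c = 0 ∨ D.degree + w < P.degree) :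
    IsReducedPair φ w (pts ++ [x]) (C d * P - C c * N) (C d * M - C c * D)
      (skewMul φ (X - C (φ d / d)) N) (skewMul φ (X - C (φ d / d)) D) ∧
    (C d * P - C c * N).natDegree = P.natDegree ∧
    (skewMul φ (X - C (φ d / d)) D).natDegree = D.natDegree + 1 := by
  have hP : (C d * P - C c * N).degree = P.degree := by
    rw [← degree_neg, neg_sub]
    exact degree_C_mul_sub_eq c hd0 N P h.fst_ne_zero (hdeg.imp_right h.snd_lead.trans_lt)
  refine ⟨⟨h.fst_mem.linear_combination h.snd_mem hc hd, h.snd_mem.annihilate hd, ?_, ?_, ?_⟩,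
    natDegree_eq_of_degree_eq hP, natDegree_skewMul_X_sub_C _ h.ne_zero⟩
  · rw [hP]
    by_cases hc0 : c = 0
    · rw [hc0, C_0, zero_mul, sub_zero]
      exact (add_le_add_left (degree_C_mul_le _ _) _).trans_lt h.fst_lead
    · have hDP := hdeg.resolve_left hc0
      rcases le_total M.degree D.degree with hle | hle
      · exact (add_le_add_left
          (degree_C_mul_sub_le d c M D (Or.inr hle) (Or.inr le_rfl)) _).trans_lt hDP
      · exact (add_le_add_left
          (degree_C_mul_sub_le d c M D (Or.inr le_rfl) (Or.inr hle)) _).trans_lt h.fst_lead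
  · rw [degree_skewMul, degree_skewMul, degree_X_sub_C, add_assoc]
    exact add_le_add_right h.snd_lead _
  · rw [← degree_ne_bot, degree_skewMul, degree_X_sub_C]
    simp [h.ne_zero]

variable (φ) in
/-- `P` is an annihilator polynomial of minimal degree, and `L` an interpolation polynomial, for
the points `pts`. -/
structure IsAnnLag (pts : List (K × K)) (P L : K[X]) : Prop where
  degree_ann : P.degree = pts.length
  degree_lag : L.degree < pts.length
  value_ann : ∀ x ∈ pts, value φ x.1 P = 0
  value_lag : ∀ x ∈ pts, value φ x.1 L = x.2

lemma IsAnnLag.ne_zero {L : K[X]} (h : IsAnnLag φ pts P L) : P ≠ 0 := by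
  rw [← degree_ne_bot, h.degree_ann]
  simp

lemma IsAnnLag.step {L : K[X]} (h : IsAnnLag φ pts P L)
    (hl : IsIndep φ ((pts ++ [x]).map Prod.fst)) :
    IsAnnLag φ (pts ++ [x]) (skewMul φ (X - C (φ (value φ x.1 P) / value φ x.1 P)) P)
      (L - C ((value φ x.1 L - x.2) / value φ x.1 P) * P) := by
  have hu : value φ x.1 P ≠ 0 := by
    intro h0
    -- Otherwise `P` would have one root more than its degree admits.
    have := hl P h.ne_zero (by
      intro y hy
      simp only [List.map_append, List.mem_append, List.mem_map, List.map_cons, List.map_nil,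
        List.mem_singleton] at hy
      rcases hy with ⟨z, hz, rfl⟩ | rfl
      · exact h.value_ann z hz
      · exact h0)
    rw [h.degree_ann] at this
    simp at this
    norm_cast at this
    omega
  refine ⟨?_, ?_, fun y hy => ?_, fun y hy => ?_⟩
  · rw [degree_skewMul, degree_X_sub_C, h.degree_ann, List.length_append, add_comm]
    rfl
  · refine (degree_sub_le _ _).trans_lt (max_lt ?_ ((degree_C_mul_le _ _).trans_lt ?_))
    · refine h.degree_lag.trans ?_
      rw [List.length_append]
      norm_cast
      simp
    · rw [h.degree_ann, List.length_append]
      norm_cast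
      simp
  · rw [value_skewMul, value_X_sub_C]
    rcases List.mem_append.mp hy with hy | hy
    · rw [h.value_ann y hy]; simp
    · rw [List.mem_singleton.mp hy, div_mul_cancel₀ _ hu, sub_self]
  · rw [map_sub, value_C_mul]
    rcases List.mem_append.mp hy with hy | hy
    · rw [h.value_ann y hy, h.value_lag y hy, mul_zero, sub_zero]
    · rw [List.mem_singleton.mp hy, div_mul_cancel₀ _ hu, sub_sub_cancel]

end Module

section Algorithms

variable {K : Type} [Field K] [DecidableEq K] (F : Type) [Field F] [Fintype F] [Algebra F K]

local notation "q" => Fintype.card F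
local notation "φ" => frob F K

/-- Each point costs `O(T)` operations, as the lists have length at most `T`. -/
lemma annLag_eq (done pts : List (K × K)) {T : ℕ} (hT : (done ++ pts).length ≤ T)
    (hind : ∀ l, l <+: done ++ pts → IsIndep φ (l.map Prod.fst)) {P L : List K} (hP : Trimmed P)
    (hL : Trimmed L) (h : IsAnnLag φ done (toPoly P) (toPoly L)) :
    ∃ P' L' n, annLag q pts P L = delay n (pure (P', L')) ∧ n ≤ pts.length * (18 * T) ∧
      Trimmed P' ∧ Trimmed L' ∧ IsAnnLag φ (done ++ pts) (toPoly P') (toPoly L') := by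
  induction pts generalizing done P L with
  | nil => exact ⟨P, L, 0, by rw [annLag, zero_delay], by simp, hP, hL, by simpa using h⟩
  | cons x pts ih =>
    obtain ⟨g, r⟩ := x
    have hlP : P.length ≤ done.length + 1 := hP.length_le (by
      rw [h.degree_ann]; norm_cast; omega)
    have hlL : L.length ≤ done.length := hL.length_le h.degree_lag
    simp only [List.length_append, List.length_cons] at hT
    obtain ⟨h₁, e₁, p₁, l₁⟩ :=
      smulP_eq ((value φ g (toPoly L) - r) / value φ g (toPoly P)) P
    obtain ⟨h₂, n₂, e₂, c₂, p₂, l₂⟩ := subP_eq L h₁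
    obtain ⟨L', n₃, e₃, c₃, t₃, p₃, l₃⟩ := trim_eq h₂
    obtain ⟨P', n₄, e₄, c₄, t₄, p₄⟩ := annihilateP_eq F (value φ g (toPoly P)) P
    have hstep := h.step (x := (g, r)) (hind _ (by simp))
    obtain ⟨P'', L'', n₅, e₅, c₅, tP, tL, h₅⟩ := ih (done ++ [(g, r)]) (by simp; omega)
      (fun l hl => hind l (by simpa using hl)) t₄ t₃ (by rw [p₄, p₃, p₂, p₁]; exact hstep)
    refine ⟨P'', L'', _, by
      simp only [annLag, evalP_eq, subE, divE, op_eq, e₁, e₂, e₃, e₄, e₅, delay_bind, pure_bind,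
        delay_delay]; rfl, ?_, tP, tL, by simpa using h₅⟩
    rw [List.length_cons, Nat.add_one_mul pts.length]
    omega

/-- The matrix consists of trimmed lists, and its rows are a reduced pair whose total
degree is the number of points. -/
structure IsMinimalBasis (k : ℕ) (pts : List (K × K)) (B : Mat K) : Prop where
  trimmed₁₁ : Trimmed B.1.1
  trimmed₁₂ : Trimmed B.1.2
  trimmed₂₁ : Trimmed B.2.1
  trimmed₂₂ : Trimmed B.2.2
  reduced : IsReducedPair φ (k - 1) pts (toPoly B.1.1) (toPoly B.1.2) (toPoly B.2.1) (toPoly B.2.2)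
  natDegree_add : (toPoly B.1.1).natDegree + (toPoly B.2.2).natDegree = pts.length

/-- The rounds preserve the invariant `IsMinimalBasis` for the points treated so far. The summand
`k` in the bound for the lengths is due to the entry `B₂₁`, whose degree is at most
`deg B₂₂ + k - 1`. -/
lemma iterativeBasis_eq (k : ℕ) (done pts : List (K × K)) {T : ℕ}
    (hT : (done ++ pts).length + k ≤ T)
    (hind : ∀ l, l <+: done ++ pts → IsIndep φ (l.map Prod.fst)) {B : Mat K}
    (h : IsMinimalBasis F k done B) :
    ∃ B' n, iterativeBasis q k pts B = delay n (pure B') ∧ n ≤ pts.length * (40 * T) ∧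
      IsMinimalBasis F k (done ++ pts) B' := by
  induction pts generalizing done B with
  | nil => exact ⟨B, 0, by rw [iterativeBasis, zero_delay], by simp, by simpa using h⟩
  | cons x pts ih =>
    obtain ⟨g, r⟩ := x
    obtain ⟨⟨P, M⟩, N, D⟩ := B
    obtain ⟨tP, tM, tN, tD, hred, hsum⟩ := h
    simp only at tP tM tN tD hred hsum
    simp only [List.length_append, List.length_cons] at hT
    have hlP : P.length ≤ T := by rw [tP.length_eq hred.fst_ne_zero]; omega
    have hlD : D.length ≤ T := by rw [tD.length_eq hred.ne_zero]; omega
    have hlM : M.length ≤ T := by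
      refine (tM.length_le (d := (toPoly P).natDegree) ?_).trans (by omega)
      rw [← degree_eq_natDegree hred.fst_ne_zero]
      exact lt_of_le_of_lt (le_add_of_nonneg_right (by positivity)) hred.fst_lead
    have hlN : N.length ≤ T := by
      refine (tN.length_le (d := (toPoly D).natDegree + (k - 1) + 1) ?_).trans (by omega)
      refine hred.snd_lead.trans_lt ?_
      rw [degree_eq_natDegree hred.ne_zero]
      norm_cast
      omega
    obtain ⟨c, hc⟩ : ∃ c, value φ g (toPoly P) + value φ r (toPoly M) = c := ⟨_, rfl⟩
    obtain ⟨d, hd⟩ : ∃ d, value φ g (toPoly N) + value φ r (toPoly D) = d := ⟨_, rfl⟩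
    have hnot := hred.not_both_zero (x := (g, r)) hsum (hind _ (by simp))
    simp only [hc, hd] at hnot
    by_cases hif : (qdeg P ≤ qdeg D + ((k - 1 : ℕ) : WithBot ℕ) ∧ decide (c = 0) = false) ∨
        decide (d = 0) = true
    · obtain ⟨P', n₁, e₁, c₁, t₁, p₁⟩ := annihilateP_eq F c P
      obtain ⟨M', n₂, e₂, c₂, t₂, p₂⟩ := annihilateP_eq F c M
      obtain ⟨N', n₃, e₃, c₃, t₃, p₃⟩ := combineP_eq d c P N
      obtain ⟨D', n₄, e₄, c₄, t₄, p₄⟩ := combineP_eq d c M D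
      -- If the second discrepancy is zero, the first one is not.
      have hc0 : c ≠ 0 := by
        rcases hif with hif | hif
        · simpa using hif.2
        · exact fun h0 => hnot h0 (by simpa using hif)
      have hdeg : d = 0 ∨ (toPoly P).degree ≤ (toPoly D).degree + ((k - 1 : ℕ) : WithBot ℕ) := by
        rw [← tP, ← tD]
        rcases hif with hif | hif
        · exact Or.inr hif.1
        · exact Or.inl (by simpa using hif)
      obtain ⟨hr', hn₁, hn₂⟩ := hred.step_fst (x := (g, r)) hc hd hc0 hdeg
      obtain ⟨B', n₅, e₅, c₅, h₅⟩ := ih (done ++ [(g, r)]) (B := ((P', M'), (N', D')))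
        (by simp; omega) (fun l hl => hind l (by simpa using hl))
        ⟨t₁, t₂, t₃, t₄, by simpa only [p₁, p₂, p₃, p₄] using hr', by
          simp only [p₁, p₄, hn₁, hn₂]; simp; omega⟩
      refine ⟨B', _, by
        simp only [iterativeBasis, evalP_eq, addE, isZeroE, op_eq, delay_bind, pure_bind,
          delay_delay, hc, hd]
        rw [if_pos hif]
        simp only [e₁, e₂, e₃, e₄, e₅, delay_bind, pure_bind, delay_delay]
        rfl, ?_, by simpa using h₅⟩
      rw [List.length_cons, Nat.add_one_mul pts.length]
      omega
    · obtain ⟨P', n₁, e₁, c₁, t₁, p₁⟩ := combineP_eq d c P N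
      obtain ⟨M', n₂, e₂, c₂, t₂, p₂⟩ := combineP_eq d c M D
      obtain ⟨N', n₃, e₃, c₃, t₃, p₃⟩ := annihilateP_eq F d N
      obtain ⟨D', n₄, e₄, c₄, t₄, p₄⟩ := annihilateP_eq F d D
      have hif' := not_or.mp hif
      have hd0 : d ≠ 0 := by simpa using hif'.2
      have hdeg : c = 0 ∨ (toPoly D).degree + ((k - 1 : ℕ) : WithBot ℕ) < (toPoly P).degree := by
        rw [← tP, ← tD]
        by_cases h0 : c = 0
        · exact Or.inl h0
        · exact Or.inr (not_le.mp fun hle => hif'.1 ⟨hle, by simpa using h0⟩)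
      obtain ⟨hr', hn₁, hn₂⟩ := hred.step_snd (x := (g, r)) hc hd hd0 hdeg
      obtain ⟨B', n₅, e₅, c₅, h₅⟩ := ih (done ++ [(g, r)]) (B := ((P', M'), (N', D')))
        (by simp; omega) (fun l hl => hind l (by simpa using hl))
        ⟨t₁, t₂, t₃, t₄, by simpa only [p₁, p₂, p₃, p₄] using hr', by
          simp only [p₁, p₄, hn₁, hn₂]; simp; omega⟩
      refine ⟨B', _, by
        simp only [iterativeBasis, evalP_eq, addE, isZeroE, op_eq, delay_bind, pure_bind,
          delay_delay, hc, hd]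
        rw [if_neg hif]
        simp only [e₁, e₂, e₃, e₄, e₅, delay_bind, pure_bind, delay_delay]
        rfl, ?_, by simpa using h₅⟩
      rw [List.length_cons, Nat.add_one_mul pts.length]
      omega

end Algorithms

/-! ### The Euclidean algorithm -/

section Euclid

variable {K : Type} [Field K] [DecidableEq K] (F : Type) [Field F] [Fintype F] [Algebra F K]

local notation "q" => Fintype.card F
local notation "φ" => frob F K

/-- The invariant of the Euclidean loop: the degrees in the first column decrease, those in the
second column increase, and the degrees of the diagonal entries add up to the number of points. -/
structure IsEuclidState (k : ℕ) (pts : List (K × K)) (B : Mat K) : Prop where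
  trimmed₁₁ : Trimmed B.1.1
  trimmed₁₂ : Trimmed B.1.2
  trimmed₂₁ : Trimmed B.2.1
  trimmed₂₂ : Trimmed B.2.2
  fst_mem : Interpolates φ pts (toPoly B.1.1) (toPoly B.1.2)
  snd_mem : Interpolates φ pts (toPoly B.2.1) (toPoly B.2.2)
  fst_lead : (toPoly B.1.2).degree + (k - 1 : ℕ) < (toPoly B.1.1).degree
  degree_lt : (toPoly B.2.1).degree < (toPoly B.1.1).degree
  degree_lt' : (toPoly B.1.2).degree < (toPoly B.2.2).degree
  natDegree_add : (toPoly B.1.1).natDegree + (toPoly B.2.2).natDegree = pts.length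

omit [DecidableEq K] in
/-- The quotient `p` has degree `deg P - deg N`, which is what the second column gains. -/
lemma IsEuclidState.step {k : ℕ} {pts : List (K × K)} {P M N D : List K}
    (h : IsEuclidState F k pts ((P, M), (N, D)))
    (hlt : (toPoly D).degree + (k - 1 : ℕ) < (toPoly N).degree) {p : K[X]} {r M' : List K}
    (hr : Trimmed r) (hM' : Trimmed M') (hdiv : toPoly P = skewMul φ p (toPoly N) + toPoly r)
    (hrN : (toPoly r).degree < (toPoly N).degree)
    (hM : toPoly M' = toPoly M - skewMul φ p (toPoly D)) :
    IsEuclidState F k pts ((N, D), (r, M')) := by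
  obtain ⟨tP, tM, tN, tD, m₁, m₂, lead, hd, hd', hsum⟩ := h
  simp only at *
  have hN0 : toPoly N ≠ 0 := by intro h0; simp [h0] at hlt
  have hP0 : toPoly P ≠ 0 := by intro h0; simp [h0] at hd
  have hD0 : toPoly D ≠ 0 := by intro h0; simp [h0] at hd'
  have hp0 : p ≠ 0 := by
    rintro rfl
    rw [skewMul_zero_left, zero_add] at hdiv
    rw [hdiv] at hd
    exact lt_asymm hd hrN
  have hdegP : (toPoly P).degree = p.degree + (toPoly N).degree := by
    rw [hdiv, degree_add_eq_left_of_degree_lt, degree_skewMul]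
    rw [degree_skewMul]
    refine hrN.trans_le (le_add_of_nonneg_left (zero_le_degree_iff.mpr hp0))
  have hlt' : (toPoly M).degree < (skewMul φ p (toPoly D)).degree := by
    rw [degree_skewMul]
    exact hd'.trans_le (le_add_of_nonneg_left (zero_le_degree_iff.mpr hp0))
  have hdegM : (toPoly M').degree = p.degree + (toPoly D).degree := by
    rw [hM, degree_sub_eq_right_of_degree_lt hlt', degree_skewMul]
  have hM0 : toPoly M' ≠ 0 := by
    rw [← degree_ne_bot, hdegM]
    simp [hp0, hD0]
  rw [degree_eq_natDegree hP0, degree_eq_natDegree hp0, degree_eq_natDegree hN0] at hdegP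
  have hdegM' := hdegM
  rw [degree_eq_natDegree hM0, degree_eq_natDegree hp0, degree_eq_natDegree hD0] at hdegM'
  rw [degree_eq_natDegree hP0, degree_eq_natDegree hN0] at hd
  norm_cast at hdegP hdegM' hd
  refine ⟨tN, tD, hr, hM', m₂, ?_, hlt, hrN, ?_, ?_⟩
  · intro x hx
    have e₁ := congrArg (value φ x.1) hdiv
    have e₂ := congrArg (value φ x.2) hM
    have h₀ : value φ (value φ x.1 (toPoly N) + value φ x.2 (toPoly D)) p = 0 := by
      rw [m₂ x hx, value_zero_point]
    rw [map_add, value_skewMul] at e₁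
    rw [map_sub, value_skewMul] at e₂
    rw [value_add_point] at h₀
    linear_combination m₁ x hx - e₁ + e₂ - h₀
  · simp only
    rw [degree_eq_natDegree hM0, degree_eq_natDegree hD0]
    norm_cast
    omega
  · simp only
    omega

/-- A round takes `O(T)` operations for each coefficient of the quotient, and the total length of
the first column decreases by at least the length of the quotient. -/
lemma euclidLoop_eq (k : ℕ) (pts : List (K × K)) {T : ℕ} (hT : pts.length + 1 ≤ T) (s : ℕ)
    {B : Mat K} (hs : B.2.1.length ≤ s) (h : IsEuclidState F k pts B) :
    ∃ B' n, whileLoop (euclidStep q k) B = delay n (pure B') ∧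
      n ≤ 20 * T * (B.1.1.length + B.2.1.length) ∧ IsMinimalBasis F k pts B' := by
  induction s using Nat.strong_induction_on generalizing B with
  | _ s ih =>
    obtain ⟨⟨P, M⟩, N, D⟩ := B
    have h' := h
    obtain ⟨tP, tM, tN, tD, m₁, m₂, lead, hd, hd', hsum⟩ := h'
    simp only at *
    have hD0 : toPoly D ≠ 0 := by intro h0; simp [h0] at hd'
    have hP0 : toPoly P ≠ 0 := by intro h0; simp [h0] at hd
    by_cases hif : qdeg D + ((k - 1 : ℕ) : WithBot ℕ) < qdeg N
    · have hlt := hif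
      rw [tD, tN] at hlt
      have hN0 : N ≠ [] := by rintro rfl; simp at hlt
      obtain ⟨p, r, n₁, e₁, c₁, h₁, tr, lp, lr⟩ := divRight_eq F (f := P) tN hN0
      obtain ⟨h₂, n₂, e₂, c₂, t₂, p₂, l₂⟩ := compP_eq F p D
      obtain ⟨h₃, n₃, e₃, c₃, p₃, l₃⟩ := subP_eq M h₂
      obtain ⟨M', n₄, e₄, c₄, t₄, p₄, l₄⟩ := trim_eq h₃
      have hlN := tN.length_eq (tN.toPoly_ne_zero hN0)
      have hstep := h.step F hlt tr t₄ h₁ (by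
        refine (degree_toPoly_lt r).trans_le ?_
        rw [degree_eq_natDegree (tN.toPoly_ne_zero hN0)]
        norm_cast
        omega) (by rw [p₄, p₃, p₂])
      obtain ⟨B', n₅, e₅, c₅, h₅⟩ := ih r.length (lr.trans_le hs) (B := ((N, D), (r, M')))
        le_rfl hstep
      refine ⟨B', n₁ + (n₂ + (n₃ + n₄)) + n₅, ?_, ?_, h₅⟩
      · rw [whileLoop_inl, e₅, delay_delay]
        simp only [euclidStep]
        rw [if_pos hif]
        simp only [e₁, e₂, e₃, e₄, delay_bind, pure_bind, delay_delay]
      · have hlP := tP.length_eq hP0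
        have hlD := tD.length_eq hD0
        have hNP : N.length < P.length := by
          rw [degree_eq_natDegree hP0, degree_eq_natDegree (tN.toPoly_ne_zero hN0)] at hd
          norm_cast at hd
          omega
        have hlM : M.length ≤ T := by
          refine (tM.length_le (d := (toPoly D).natDegree) ?_).trans (by omega)
          rwa [← degree_eq_natDegree hD0]
        obtain ⟨s', hs'⟩ : ∃ s', P.length + 1 - N.length = s' := ⟨_, rfl⟩
        rw [hs'] at c₁ lp
        have b₁ : n₁ ≤ s' * (6 * T) + T :=
          c₁.trans (add_le_add (Nat.mul_le_mul_left _ (by omega)) (by omega))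
        have b₂ : n₂ ≤ s' * (3 * T) + s' + T := by
          have : 3 * p.length * D.length ≤ s' * (3 * T) := by
            calc _ = p.length * (3 * D.length) := by ring
              _ ≤ _ := Nat.mul_le_mul lp (by omega)
          omega
        simp only at c₅
        -- The old `N` is the new `P`, and the remainder is shorter than `N`.
        have hpot : N.length + r.length + s' ≤ P.length + N.length := by omega
        have h20 : 20 * T * (N.length + r.length) + 20 * T * s' ≤
            20 * T * (P.length + N.length) := by
          rw [← mul_add]
          exact Nat.mul_le_mul_left _ hpot
        have hs1 : T ≤ T * s' := Nat.le_mul_of_pos_right _ (by omega)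
        have hs2 : s' ≤ T * s' := Nat.le_mul_of_pos_left _ (by omega)
        have b₁' : n₁ ≤ 6 * (T * s') + T := b₁.trans_eq (by ring)
        have b₂' : n₂ ≤ 3 * (T * s') + s' + T := b₂.trans_eq (by ring)
        have h20' : 20 * T * (N.length + r.length) + 20 * (T * s') ≤
            20 * T * (P.length + N.length) := by
          rw [← mul_assoc]; exact h20
        omega
    · refine ⟨((P, M), (N, D)), 0, ?_, by simp, tP, tM, tN, tD, ⟨m₁, m₂, lead, ?_, hD0⟩, hsum⟩
      · refine whileLoop_inr ?_
        simp only [euclidStep]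
        rw [if_neg hif, zero_delay]
      · rw [← tD, ← tN]
        exact not_lt.mp hif

omit [DecidableEq K] in
lemma Trimmed.of_degree_eq {f g : List K} (hf : Trimmed f) (hl : g.length = f.length)
    (hd : (toPoly g).degree = (toPoly f).degree) : Trimmed g := by
  rw [Trimmed, hd, ← hf]
  cases f <;> cases g <;> simp_all [qdeg]

lemma euclidBasis_eq (k : ℕ) (pts : List (K × K)) {T : ℕ} (hT : pts.length + k ≤ T) (hk : 1 ≤ k)
    {P L : List K} (hP : Trimmed P) (hL : Trimmed L)
    (h : IsAnnLag φ pts (toPoly P) (toPoly L)) :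
    ∃ B n, euclidBasis q k P L = delay n (pure B) ∧ n ≤ 41 * T ^ 2 ∧ IsMinimalBasis F k pts B := by
  obtain ⟨N, n₁, e₁, c₁, p₁, l₁⟩ := subP_eq [] L
  have hlP := hP.length_eq h.ne_zero
  have hlL : L.length ≤ pts.length := hL.length_le h.degree_lag
  have hnat : (toPoly P).natDegree = pts.length := natDegree_eq_of_degree_eq_some h.degree_ann
  rw [toPoly_nil, zero_sub] at p₁
  have hstate : IsEuclidState F k pts ((P, []), (N, [1])) := by
    refine ⟨hP, trimmed_nil, hL.of_degree_eq (by simpa using l₁) (by rw [p₁, degree_neg]),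
      trimmed_singleton_one, ?_, ?_, ?_, ?_, ?_, ?_⟩
    · intro x hx
      simp [h.value_ann x hx]
    · intro x hx
      simp only [p₁, map_neg, h.value_lag x hx, toPoly_cons, toPoly_nil, mul_zero, add_zero,
        value_C]
      ring
    · simp [bot_lt_iff_ne_bot, h.ne_zero]
    · simp only [p₁, degree_neg, h.degree_ann]
      exact h.degree_lag
    · simp
    · simp [hnat]
  obtain ⟨B, n₂, e₂, c₂, h₂⟩ := euclidLoop_eq F k pts (T := T) (by omega) _ le_rfl hstate
  refine ⟨B, _, by simp only [euclidBasis, e₁, e₂, delay_bind, pure_bind, delay_delay]; rfl, ?_, h₂⟩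
  simp only [List.length_nil] at l₁ c₂
  have : 20 * T * (P.length + N.length) ≤ 20 * T * (2 * T) := Nat.mul_le_mul_left _ (by omega)
  have hT2 : T ≤ T * T := Nat.le_mul_of_pos_left _ (by omega)
  have e : 20 * T * (2 * T) = 40 * (T * T) := by ring
  rw [pow_two]
  omega

end Euclid

/-! ### The search -/

section Search

variable {K : Type}

lemma length_allLists (elems : List K) (d : ℕ) :
    (allLists elems d).length = elems.length ^ d := by
  induction d with
  | zero => rfl
  | succ d ih => simp [allLists, List.length_flatMap, ih, pow_succ]

lemma mem_allLists {elems : List K} (hall : ∀ x : K, x ∈ elems) {d : ℕ} {f : List K} :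
    f ∈ allLists elems d ↔ f.length = d := by
  induction d generalizing f with
  | zero => simp [allLists]
  | succ d ih =>
    simp only [allLists, List.mem_flatMap, List.mem_map, ih]
    constructor
    · rintro ⟨g, hg, a, -, rfl⟩
      simp [hg]
    · intro hf
      cases f with
      | nil => simp at hf
      | cons a f => exact ⟨f, by simpa using hf, a, hall a, rfl⟩

/-- The last term of a sum of increasing powers dominates. -/
lemma sum_pow_le_two_mul {Q : ℕ} (hQ : 2 ≤ Q) {e : ℕ → ℕ} (he : StrictMono e) (J : ℕ) :
    ∑ i ∈ Finset.range (J + 1), Q ^ e i ≤ 2 * Q ^ e J := by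
  induction J with
  | zero => simp; omega
  | succ J ih =>
    rw [Finset.sum_range_succ]
    have h1 : Q ^ (e J + 1) ≤ Q ^ e (J + 1) :=
      Nat.pow_le_pow_right (by omega) (he (Nat.lt_succ_self J))
    have h2 : 2 * Q ^ e J ≤ Q ^ (e J + 1) := by
      rw [pow_succ, mul_comm]
      exact Nat.mul_le_mul_left _ hQ
    omega

variable [Field K] [DecidableEq K] (F : Type) [Field F] [Fintype F] [Algebra F K]

local notation "q" => Fintype.card F
local notation "φ" => frob F K

/-- A crude bound, in which the length of `g` does not matter if `f = 0`. In the search this covers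
the rounds in which the first basis row is too large to contribute. -/
lemma compP_le {f g : List K} {T : ℕ} (h : f = [] ∨ f.length + (g.length - 1) ≤ T) :
    ∃ h n, compP q f g = delay n (pure h) ∧ n ≤ 5 * T ^ 2 ∧
      toPoly h = skewMul φ (toPoly f) (toPoly g) ∧ h.length ≤ T := by
  by_cases hf : f = []
  · subst hf
    exact ⟨[], 0, by simp [compP, compAux, trim, zero_delay], by simp, by simp, by simp⟩
  · have hpos := List.length_pos_of_ne_nil hf
    have hle := h.resolve_left hf
    obtain ⟨h, n, e, cn, -, p, l⟩ := compP_eq F f g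
    refine ⟨h, n, e, cn.trans ?_, p, by omega⟩
    have h1 : f.length ≤ T := by omega
    have h2 : g.length ≤ T := by omega
    have h3 : f.length * g.length ≤ T * T := Nat.mul_le_mul h1 h2
    have h4 : T ≤ T * T := Nat.le_mul_of_pos_left _ (by omega)
    rw [mul_assoc, pow_two]
    omega

variable {F} {k : ℕ} {pts : List (K × K)} {B : Mat K}

omit [DecidableEq K] in
lemma IsMinimalBasis.weightedDeg_fst (h : IsMinimalBasis F k pts B) :
    weightedDeg k B.1 = (toPoly B.1.1).natDegree := by
  have h1 := h.reduced.fst_lead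
  rw [weightedDeg, h.trimmed₁₁, h.trimmed₁₂, max_eq_left h1.le,
    degree_eq_natDegree h.reduced.fst_ne_zero]
  rfl

omit [DecidableEq K] in
lemma IsMinimalBasis.weightedDeg_snd (h : IsMinimalBasis F k pts B) :
    weightedDeg k B.2 = ((toPoly B.2.2).natDegree + (k - 1) : ℕ) := by
  have h1 := h.reduced.snd_lead
  rw [weightedDeg, h.trimmed₂₁, h.trimmed₂₂, max_eq_right h1,
    degree_eq_natDegree h.reduced.ne_zero]
  rfl

variable [Fintype K]

/-- Only one direction of the test is recorded: a pair that passes it can only end the search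
earlier. -/
lemma tryPair_eq (h : IsMinimalBasis F k pts B) {β γ : List K} {T : ℕ}
    (hβ : β = [] ∨ β.length + (toPoly B.1.1).natDegree ≤ T) (hγ0 : γ ≠ [])
    (hγ : γ.length + ((toPoly B.2.2).natDegree + (k - 1)) ≤ T) :
    ∃ o n, tryPair q (Module.finrank F K) B (β, γ) = delay n (pure o) ∧ n ≤ 35 * T ^ 2 ∧
      ((∃ μ, skewMul φ (toPoly β) (toPoly B.1.1) + skewMul φ (toPoly γ) (toPoly B.2.1) =
        skewMul φ (skewMul φ (toPoly β) (toPoly B.1.2) + skewMul φ (toPoly γ) (toPoly B.2.2)) μ) →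
        o.isSome) := by
  obtain ⟨⟨P, M⟩, N, D⟩ := B
  obtain ⟨tP, tM, tN, tD, hred, hsum⟩ := h
  simp only at *
  have hγpos := List.length_pos_of_ne_nil hγ0
  have lP := tP.length_eq hred.fst_ne_zero
  have lD := tD.length_eq hred.ne_zero
  have lM : M.length ≤ (toPoly P).natDegree := by
    refine tM.length_le ?_
    rw [← degree_eq_natDegree hred.fst_ne_zero]
    exact lt_of_le_of_lt (le_add_of_nonneg_right (by positivity)) hred.fst_lead
  have lN : N.length ≤ (toPoly D).natDegree + (k - 1) + 1 := by
    refine tN.length_le (hred.snd_lead.trans_lt ?_)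
    rw [degree_eq_natDegree hred.ne_zero]
    norm_cast
    omega
  obtain ⟨β', n₀, e₀, c₀, t₀, p₀, l₀⟩ := trim_eq β
  have hβ' : β' = [] ∨ β'.length + (toPoly P).natDegree ≤ T := by
    rcases hβ with rfl | hβ
    · exact Or.inl (List.length_eq_zero_iff.mp (by simpa using l₀))
    · exact Or.inr (by omega)
  have hβT : β.length ≤ T := by
    rcases hβ with rfl | hβ
    · simp
    · omega
  obtain ⟨h₁, n₁, e₁, c₁, p₁, l₁⟩ := compP_le F (f := β') (g := P) (T := T)
    (hβ'.imp_right fun h => by omega)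
  obtain ⟨h₂, n₂, e₂, c₂, p₂, l₂⟩ := compP_le F (f := γ) (g := N) (T := T) (Or.inr (by omega))
  obtain ⟨s₁, n₃, e₃, c₃, p₃, l₃⟩ := addP_eq h₁ h₂
  obtain ⟨f₁, n₄, e₄, c₄, t₄, p₄, l₄⟩ := trim_eq s₁
  obtain ⟨h₅, n₅, e₅, c₅, p₅, l₅⟩ := compP_le F (f := β') (g := M) (T := T)
    (hβ'.imp_right fun h => by omega)
  obtain ⟨h₆, n₆, e₆, c₆, p₆, l₆⟩ := compP_le F (f := γ) (g := D) (T := T) (Or.inr (by omega))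
  obtain ⟨s₂, n₇, e₇, c₇, p₇, l₇⟩ := addP_eq h₅ h₆
  obtain ⟨f₂, n₈, e₈, c₈, t₈, p₈, l₈⟩ := trim_eq s₂
  obtain ⟨o, n₉, e₉, c₉, ho⟩ := quotientLeft_eq F (T := T) t₄ t₈ (by omega) (by omega)
  refine ⟨o, _, by
    simp only [tryPair, charge_bind, e₀, e₁, e₂, e₃, e₄, e₅, e₆, e₇, e₈, e₉, delay_bind, pure_bind,
      delay_delay]; rfl, ?_, fun ⟨μ, hμ⟩ => ho ⟨μ, ?_⟩⟩
  · have h4 : T ≤ T * T := Nat.le_mul_of_pos_left _ (by omega)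
    rw [pow_two] at *
    omega
  · rw [p₄, p₃, p₁, p₂, p₀, hμ, p₈, p₇, p₅, p₆, p₀]

variable (F k B) in
/-- The number of coefficients of `β` in round `j` of the search: `ℓ₂ - ℓ₁ + j + 1`, or `0` if this
is negative, in which case only `β = 0` is tried. -/
def numCoeffs (j : ℕ) : ℕ := (weightedDeg k B.2 - weightedDeg k B.1 + j + 1).toNat

variable (F k B) in
/-- Some pair `(β, γ)` that is formed in round `j` of the search passes the test. -/
def Hit (j : ℕ) : Prop :=
  ∃ β γ : List K, β.length = numCoeffs k B j ∧ γ.length = j ∧ ∃ μ,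
    skewMul φ (toPoly β) (toPoly B.1.1) + skewMul φ (toPoly (γ ++ [1])) (toPoly B.2.1) =
      skewMul φ (skewMul φ (toPoly β) (toPoly B.1.2) +
        skewMul φ (toPoly (γ ++ [1])) (toPoly B.2.2)) μ

/-- Round `j` forms `|K| ^ (numCoeffs k B j + j)` pairs, since `γ` is monic with `j` free
coefficients. -/
lemma searchStep_eq (h : IsMinimalBasis F k pts B) {elems : List K} (hnodup : elems.Nodup)
    (hall : ∀ x : K, x ∈ elems) {j T : ℕ}
    (hT : j + 1 + ((toPoly B.2.2).natDegree + (k - 1)) ≤ T) :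
    ∃ res n, searchStep q (Module.finrank F K) k elems B j = delay n (pure res) ∧
      n ≤ Fintype.card K ^ (numCoeffs k B j + j) * (35 * T ^ 2) ∧
      ((∃ out, res = Sum.inr out) ∨ (res = Sum.inl (j + 1) ∧ ¬ Hit F k B j)) := by
  have hcard : elems.length = Fintype.card K := by
    rw [← List.toFinset_card_of_nodup hnodup, ← Finset.card_univ]
    congr 1
    ext x
    simp [hall]
  obtain ⟨found, n, e, cn, hf⟩ := mapM_eq (f := tryPair q (Module.finrank F K) B)
    (P := fun x o => (∃ μ,
      skewMul φ (toPoly x.1) (toPoly B.1.1) + skewMul φ (toPoly x.2) (toPoly B.2.1) =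
      skewMul φ (skewMul φ (toPoly x.1) (toPoly B.1.2) +
        skewMul φ (toPoly x.2) (toPoly B.2.2)) μ) → o.isSome) (N := 35 * T ^ 2)
    ((allLists elems (numCoeffs k B j)).product ((allLists elems j).map fun γ => γ ++ [1])) (by
      rintro ⟨β, γ'⟩ hx
      rw [List.pair_mem_product, List.mem_map] at hx
      obtain ⟨hβ, γ, hγ, rfl⟩ := hx
      rw [mem_allLists hall] at hβ hγ
      refine tryPair_eq h ?_ (by simp) (by simp; omega)
      rw [numCoeffs, h.weightedDeg_fst, h.weightedDeg_snd] at hβ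
      by_cases h0 : β.length = 0
      · exact Or.inl (List.length_eq_zero_iff.mp h0)
      · right
        omega)
  refine ⟨if found.reduceOption = [] then Sum.inl (j + 1) else Sum.inr found.reduceOption, n, ?_,
    ?_, ?_⟩
  · simp only [searchStep]
    rw [← numCoeffs, e, delay_bind, pure_bind]
  · have hlen := List.length_product (allLists elems (numCoeffs k B j))
      ((allLists elems j).map fun γ => γ ++ [1])
    change List.length (List.product _ _) = _ at hlen
    rwa [hlen, List.length_map, length_allLists, length_allLists, hcard,
      ← pow_add] at cn
  · split_ifs with hempty
    · refine Or.inr ⟨rfl, ?_⟩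
      rintro ⟨β, γ, hβ, hγ, hμ⟩
      have hmem : (β, γ ++ [1]) ∈ (allLists elems (numCoeffs k B j)).product
          ((allLists elems j).map fun γ => γ ++ [1]) := by
        rw [List.pair_mem_product, List.mem_map]
        exact ⟨(mem_allLists hall).mpr hβ, γ, (mem_allLists hall).mpr hγ, rfl⟩
      obtain ⟨i, hi, hx⟩ := List.getElem_of_mem hmem
      have hi' : i < found.length := hf.length_eq ▸ hi
      have hsome := hf.get hi hi' (by simpa only [List.get_eq_getElem, hx] using hμ)
      obtain ⟨a, ha⟩ := Option.isSome_iff_exists.mp hsome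
      have : a ∈ found.reduceOption := by
        rw [List.reduceOption_mem_iff, ← ha]
        exact List.get_mem _ _
      simp [hempty] at this
    · exact Or.inl ⟨_, rfl⟩

/-- The search stops in round `J` at the latest if some pair of that round passes the test. -/
lemma searchLoop_eq (h : IsMinimalBasis F k pts B) {elems : List K} (hnodup : elems.Nodup)
    (hall : ∀ x : K, x ∈ elems) {J T : ℕ}
    (hT : J + 1 + ((toPoly B.2.2).natDegree + (k - 1)) ≤ T) (hJ : Hit F k B J) {j : ℕ}
    (hj : j ≤ J) :
    ∃ out n, whileLoop (searchStep q (Module.finrank F K) k elems B) j = delay n (pure out) ∧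
      n ≤ (∑ i ∈ Finset.Ico j (J + 1), Fintype.card K ^ (numCoeffs k B i + i)) * (35 * T ^ 2) := by
  induction hd : J - j generalizing j with
  | zero =>
    obtain rfl : j = J := by omega
    obtain ⟨res, n, e, cn, hres⟩ := searchStep_eq h hnodup hall hT
    obtain ⟨out, rfl⟩ := hres.resolve_right fun hno => hno.2 hJ
    exact ⟨out, n, whileLoop_inr e, by simpa using cn⟩
  | succ d ih =>
    obtain ⟨res, n, e, cn, hres⟩ := searchStep_eq (j := j) (T := T) h hnodup hall (by omega)
    rw [Finset.sum_eq_sum_Ico_succ_bot (by omega), add_mul]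
    rcases hres with ⟨out, rfl⟩ | ⟨rfl, -⟩
    · exact ⟨out, n, whileLoop_inr e, by omega⟩
    · obtain ⟨out, n', e', cn'⟩ := ih (j := j + 1) (by omega) (by omega)
      exact ⟨out, n + n', by rw [whileLoop_inl e, e', delay_delay], by omega⟩

end Search

/-! ### The decoder -/

section Decoder

variable {K : Type} [Field K] {F : Type} [Field F] [Fintype F] [Algebra F K]

local notation "q" => Fintype.card F
local notation "φ" => frob F K

/-- The lists `γ ++ [1]` in the search represent all monic polynomials. -/
lemma toPoly_append_one {γ : K[X]} (hγ : γ.Monic) :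
    ∃ l : List K, l.length = γ.natDegree ∧ toPoly (l ++ [1]) = γ := by
  obtain ⟨l, hl, e⟩ := exists_toPoly_eq (p := γ - X ^ γ.natDegree) (d := γ.natDegree) (by
    rw [← degree_eq_natDegree hγ.ne_zero]
    apply degree_sub_lt_left _ hγ.ne_zero
    · rw [hγ.leadingCoeff, leadingCoeff_X_pow]
    · rw [degree_X_pow, degree_eq_natDegree hγ.ne_zero])
  refine ⟨l, hl, ?_⟩
  rw [toPoly_append, e, hl]
  simp

/-- A row `(E ∘ μ, E)` of the interpolation module, with `μ` of degree below `k`, leads to a hit in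
the round `J` determined by the degree of `E`. If there is no room for a nonzero `β` in that round,
the row is a left multiple of the second basis row, and cancellation gives a hit in round `0`. -/
lemma exists_hit {k : ℕ} (hk : 1 ≤ k) {pts : List (K × K)} {B : Mat K}
    (h : IsMinimalBasis F k pts B) (hl : IsIndep φ (pts.map Prod.fst)) {E μ : K[X]} (hE : E ≠ 0)
    (hμ : μ.degree < k) (hmem : Interpolates φ pts (skewMul φ E μ) E) :
    ∃ J, J + (toPoly B.2.2).natDegree = E.natDegree ∧ Hit F k B J ∧
      ((toPoly B.1.1).natDegree ≤ (toPoly B.2.2).natDegree + (k - 1) + J ∨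
        (Hit F k B 0 ∧ numCoeffs k B 0 = 0)) := by
  obtain ⟨β, γ, h₁, h₂⟩ := h.reduced.exists_combination hl h.natDegree_add hmem
  have hμ' : μ.degree ≤ (k - 1 : ℕ) := le_of_lt_succ (by rwa [Nat.sub_add_cancel hk])
  obtain ⟨hγ, hdeg, hβ⟩ := h.reduced.degree_combination (β := β) (γ := γ) (h₂ ▸ hE) (by
    rw [← h₁, ← h₂, degree_skewMul]
    exact add_le_add_right hμ' _)
  rw [← h₂, degree_eq_natDegree hE, degree_eq_natDegree hγ,
    degree_eq_natDegree h.reduced.ne_zero] at hdeg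
  rw [degree_eq_natDegree hγ, degree_eq_natDegree h.reduced.ne_zero,
    degree_eq_natDegree h.reduced.fst_ne_zero] at hβ
  norm_cast at hdeg
  -- Left multiplication by a constant makes `γ` monic, as the search requires.
  have hlc : γ.leadingCoeff⁻¹ ≠ 0 := inv_ne_zero (leadingCoeff_ne_zero.mpr hγ)
  have hmonic : (C γ.leadingCoeff⁻¹ * γ).Monic := by
    rw [mul_comm]; exact monic_mul_leadingCoeff_inv hγ
  obtain ⟨lγ, hlγ, eγ⟩ := toPoly_append_one hmonic
  rw [natDegree_C_mul hlc] at hlγ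
  have hnum (j : ℕ) : numCoeffs k B j = (((toPoly B.2.2).natDegree + (k - 1) : ℕ) -
      ((toPoly B.1.1).natDegree : ℤ) + j + 1).toNat := by
    rw [numCoeffs, h.weightedDeg_fst, h.weightedDeg_snd]
  obtain ⟨lβ, hlβ, eβ⟩ := exists_toPoly_eq (p := C γ.leadingCoeff⁻¹ * β)
      (d := numCoeffs k B γ.natDegree) (by
    rw [degree_C_mul hlc]
    rcases eq_or_ne β 0 with rfl | hβ0
    · simp [bot_lt_iff_ne_bot]
    · rw [degree_eq_natDegree hβ0] at hβ ⊢
      norm_cast at hβ ⊢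
      rw [hnum]
      omega)
  refine ⟨γ.natDegree, hdeg.symm, ⟨lβ, lγ, hlβ, hlγ, μ, ?_⟩, ?_⟩
  · simp only [eβ, eγ, skewMul_C_mul_left, ← mul_add]
    rw [← h₁, ← h₂]
  · by_cases hle : (toPoly B.1.1).natDegree ≤ (toPoly B.2.2).natDegree + (k - 1) + γ.natDegree
    · exact Or.inl hle
    · right
      have hβ0 : β = 0 := by
        by_contra hβ0
        rw [degree_eq_natDegree hβ0] at hβ
        norm_cast at hβ
        omega
      have hN : toPoly B.2.1 = skewMul φ (toPoly B.2.2) μ := by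
        apply skewMul_left_cancel hγ
        rw [hβ0, skewMul_zero_left, zero_add] at h₁ h₂
        rw [← h₁, h₂, skewMul_assoc]
      have h0 : numCoeffs k B 0 = 0 := by rw [hnum]; omega
      exact ⟨⟨[], [], h0.symm, rfl, μ, by simp [hN]⟩, h0⟩

/-- Both recursive constructions need independence of the points treated so far. -/
lemma isIndep_of_prefix {n : ℕ} {g : Fin n → K} (hg : LinearIndependent F g) (r : Fin n → K)
    {l : List (K × K)} (hl : l <+: List.ofFn fun i => (g i, r i)) :
    IsIndep φ (l.map Prod.fst) := by
  have hlen : l.length ≤ n := by simpa using hl.length_le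
  have hl' : l.map Prod.fst = List.ofFn (fun i : Fin l.length => g (Fin.castLE hlen i)) := by
    apply List.ext_getElem
    · simp
    · intro i h₁ h₂
      rw [List.getElem_map, hl.getElem]
      simp
  rw [hl']
  exact isIndep_of_linearIndependent (hg.comp _ (Fin.castLE_injective hlen))

variable [DecidableEq K]

/-- Either basis method yields a minimal basis in quadratic time. -/
lemma exists_basis {k : ℕ} (hk : 1 ≤ k) {pts : List (K × K)} (hkn : k ≤ pts.length)
    (hind : ∀ l, l <+: pts → IsIndep φ (l.map Prod.fst)) (method : BasisMethod) :
    ∃ (B : Mat K) (N : ℕ), N ≤ 182 * pts.length ^ 2 ∧ IsMinimalBasis F k pts B ∧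
      ∀ (m : ℕ) (elems : List K), listDecode q m k elems method pts =
        delay N (whileLoop (searchStep q m k elems B) 0) := by
  have h₀ : IsAnnLag φ [] (toPoly [(1 : K)]) (toPoly []) :=
    ⟨by simp, by simp, by simp, by simp⟩
  obtain ⟨P, L, n₁, e₁, c₁, tP, tL, h₁⟩ := annLag_eq F [] pts (T := pts.length) (by simp)
    (by simpa using hind) trimmed_singleton_one trimmed_nil h₀
  rw [List.nil_append] at h₁
  have hc₁ : n₁ ≤ 18 * pts.length ^ 2 := c₁.trans_eq (by ring)
  cases method with
  | euclid =>
    obtain ⟨B, n₂, e₂, c₂, h₂⟩ := euclidBasis_eq F k pts (T := 2 * pts.length) (by omega) hk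
      tP tL h₁
    refine ⟨B, n₁ + n₂, ?_, h₂, fun m elems => ?_⟩
    · rw [mul_pow] at c₂
      omega
    · simp only [listDecode, e₁, e₂, delay_bind, pure_bind, delay_delay]
  | iterative =>
    obtain ⟨B, n₂, e₂, c₂, h₂⟩ := iterativeBasis_eq F k [] pts (T := 2 * pts.length)
      (B := (([1], []), ([], [1]))) (by simp; omega) (by simpa using hind)
      ⟨trimmed_singleton_one, trimmed_nil, trimmed_nil, trimmed_singleton_one,
        ⟨by simp [Interpolates], by simp [Interpolates], by simp, by simp, by simp⟩, by simp⟩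
    refine ⟨B, n₁ + n₂, ?_, by simpa using h₂, fun m elems => ?_⟩
    · have : n₂ ≤ 80 * pts.length ^ 2 := c₂.trans_eq (by ring)
      omega
    · simp only [listDecode, e₁, e₂, delay_bind, pure_bind, delay_delay]

variable [Fintype K]

/-- The search takes `O(n ^ 2)` operations if it stops in round `0` for want of a nonzero `β`, and
otherwise its last round dominates. -/
lemma exists_search {k : ℕ} (hk : 1 ≤ k) {pts : List (K × K)} (hkn : k ≤ pts.length) {B : Mat K}
    (h : IsMinimalBasis F k pts B) (hl : IsIndep φ (pts.map Prod.fst)) {elems : List K}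
    (hnodup : elems.Nodup) (hall : ∀ x : K, x ∈ elems) {E μ : K[X]} (hE : E ≠ 0)
    (hμ : μ.degree < k) (hmem : Interpolates φ pts (skewMul φ E μ) E) :
    ∃ out n, whileLoop (searchStep q (Module.finrank F K) k elems B) 0 = delay n (pure out) ∧
      (n ≤ 140 * pts.length ^ 2 ∨ ∃ e : ℕ, (e : ℤ) = 2 * E.natDegree + k - pts.length ∧
        n ≤ 70 * (q ^ (Module.finrank F K * e) * (E.natDegree + k) ^ 2)) := by
  obtain ⟨J, hJ, hit, hcase⟩ := exists_hit hk h hl hE hμ hmem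
  have hsum := h.natDegree_add
  rcases hcase with hle | ⟨hit₀, h0⟩
  · obtain ⟨out, n, e, cn⟩ := searchLoop_eq (T := E.natDegree + k) h hnodup hall (by omega) hit
      (Nat.zero_le _)
    refine ⟨out, n, e, Or.inr ⟨numCoeffs k B J + J, ?_, ?_⟩⟩
    · rw [numCoeffs, h.weightedDeg_fst, h.weightedDeg_snd]
      omega
    · have hmono : StrictMono fun j => numCoeffs k B j + j := by
        apply strictMono_nat_of_lt_succ
        intro j
        simp only [numCoeffs]
        omega
      have hgeom := sum_pow_le_two_mul (Q := Fintype.card K) Fintype.one_lt_card hmono J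
      rw [← Finset.range_eq_Ico] at cn
      calc n ≤ _ := cn
        _ ≤ 2 * Fintype.card K ^ (numCoeffs k B J + J) * (35 * (E.natDegree + k) ^ 2) :=
          Nat.mul_le_mul_right _ hgeom
        _ = _ := by
          rw [pow_mul, ← Module.card_eq_pow_finrank (K := F) (V := K)]
          ring
  · obtain ⟨out, n, e, cn⟩ := searchLoop_eq (T := 2 * pts.length) (J := 0) h hnodup hall (by omega)
      hit₀ le_rfl
    refine ⟨out, n, e, Or.inl ?_⟩
    simp only [zero_add, Nat.Ico_succ_singleton, Finset.sum_singleton, h0, pow_zero, one_mul,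
      add_zero] at cn
    rw [mul_pow] at cn
    omega

end Decoder

end Gabidulin

open Gabidulin in
/-- There is an absolute constant `C` such that, with `q = |F|`, `m = [K : F]`, the minimal list
decoder with either way of computing the basis stops on every input, after at most
`C (q ^ (m (2 t + k - n)) (t + k) ^ 2 + n ^ 2)` field operations, where `t` is the rank distance
from the received word to the closest codeword. -/
theorem mainTheorem6 :
    ∃ C : ℕ, ∀ (F K : Type) [Field F] [Fintype F] [Field K] [Fintype K] [DecidableEq K]
      [Algebra F K] (n k : ℕ) (_hk : 1 ≤ k) (_hkn : k ≤ n) (g r : Fin n → K)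
      (_hg : LinearIndependent F g) (elems : List K) (_hnodup : elems.Nodup)
      (_hall : ∀ x : K, x ∈ elems) (method : Gabidulin.BasisMethod) (t : ℕ)
      (_ht : IsLeast {s : ℕ | ∃ c ∈ Gabidulin.code F k g, s = Gabidulin.rankDist F c r} t),
      ∃ (out : List (List K)) (N : ℕ),
        (Gabidulin.listDecode (Fintype.card F) (Module.finrank F K) k elems method
          (List.ofFn fun i => (g i, r i))).run 0 = some (out, N) ∧
        (N : ℝ) ≤ C * ((Fintype.card F : ℝ) ^
          ((Module.finrank F K : ℤ) * (2 * (t : ℤ) + k - n)) * ((t : ℝ) + k) ^ 2 +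
            (n : ℝ) ^ 2) ∧
        ((n : ℤ) - k ≤ t → (N : ℝ) ≤ C * (((Fintype.card F : ℝ) ^
          ((Module.finrank F K : ℤ) * (2 * (t : ℤ) + k - n)) + 1) * (n : ℝ) ^ 2)) := by
  refine ⟨1288, fun F K _ _ _ _ _ _ n k hk hkn g r hg elems hnodup hall method t ht => ?_⟩
  obtain ⟨c, hc, rfl⟩ := ht.1
  have htn : rankDist F c r ≤ n := by
    simpa [rankDist] using Matrix.rank_le_card_width (expand F c - expand F r)
  obtain ⟨E, μ, hE, hEdeg, hμ, hval⟩ := exists_decodable r hc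
  set t := rankDist F c r
  set pts := List.ofFn fun i => (g i, r i) with hpts
  have hlen : pts.length = n := by simp [hpts]
  have hind (l) (hl : l <+: pts) : IsIndep (frob F K) (l.map Prod.fst) := isIndep_of_prefix hg r hl
  obtain ⟨B, n₁, c₁, hB, e₁⟩ := exists_basis hk (hlen ▸ hkn) hind method
  have hmem : Interpolates (frob F K) pts (skewMul (frob F K) E μ) E := by
    intro x hx
    obtain ⟨i, rfl⟩ := (List.mem_ofFn' _ _).mp hx
    exact hval i
  obtain ⟨out, n₂, e₂, c₂⟩ := exists_search hk (hlen ▸ hkn) hB (hind _ List.prefix_rfl)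
    hnodup hall hE hμ hmem
  rw [hlen] at c₁ c₂
  have hEt : E.natDegree ≤ t := Polynomial.natDegree_le_of_degree_le hEdeg
  have hq : (1 : ℝ) ≤ Fintype.card F := by exact_mod_cast Fintype.card_pos
  have hx0 : (0 : ℝ) ≤ (Fintype.card F : ℝ) ^
      ((Module.finrank F K : ℤ) * (2 * (t : ℤ) + k - n)) := by positivity
  have hmain : ((n₁ + n₂ : ℕ) : ℝ) ≤ 322 * ((Fintype.card F : ℝ) ^
      ((Module.finrank F K : ℤ) * (2 * (t : ℤ) + k - n)) * ((t : ℝ) + k) ^ 2 + (n : ℝ) ^ 2) := by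
    have b₁ : (n₁ : ℝ) ≤ 182 * (n : ℝ) ^ 2 := by exact_mod_cast c₁
    have hn0 : (0 : ℝ) ≤ (n : ℝ) ^ 2 := by positivity
    have hp0 : (0 : ℝ) ≤ (Fintype.card F : ℝ) ^
      ((Module.finrank F K : ℤ) * (2 * (t : ℤ) + k - n)) * ((t : ℝ) + k) ^ 2 := by positivity
    push_cast
    rcases c₂ with c₂ | ⟨e, he, c₂⟩
    · have b₂ : (n₂ : ℝ) ≤ 140 * (n : ℝ) ^ 2 := by exact_mod_cast c₂
      linarith
    · have b₂ : (n₂ : ℝ) ≤ 70 * ((Fintype.card F : ℝ) ^ (Module.finrank F K * e) *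
          ((E.natDegree : ℝ) + k) ^ 2) := by exact_mod_cast c₂
      have b₃ : (Fintype.card F : ℝ) ^ (Module.finrank F K * e) ≤ (Fintype.card F : ℝ) ^
          ((Module.finrank F K : ℤ) * (2 * (t : ℤ) + k - n)) := by
        rw [← zpow_natCast]
        apply zpow_le_zpow_right₀ hq
        push_cast
        apply mul_le_mul_of_nonneg_left _ (by positivity)
        omega
      have b₄ : ((E.natDegree : ℝ) + k) ^ 2 ≤ ((t : ℝ) + k) ^ 2 := by
        have : (E.natDegree : ℝ) ≤ t := by exact_mod_cast hEt
        gcongr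
      have b₅ := mul_le_mul b₃ b₄ (by positivity) hx0
      linarith
  refine ⟨out, n₁ + n₂, ?_, ?_, fun _ => ?_⟩
  · rw [e₁, e₂, delay_delay, delay_apply, zero_add]
    rfl
  · refine hmain.trans ?_
    push_cast
    gcongr
    norm_num
  -- The constant `1288` is `4 * 322`, from `(t + k) ^ 2 ≤ (2 * n) ^ 2`.
  · refine hmain.trans ?_
    have htk : ((t : ℝ) + k) ^ 2 ≤ (2 * n) ^ 2 := by
      have h1 : (t : ℝ) ≤ n := by exact_mod_cast htn
      have h2 : (k : ℝ) ≤ n := by exact_mod_cast hkn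
      gcongr
      linarith
    have := mul_le_mul_of_nonneg_left htk hx0
    have hn0 : (0 : ℝ) ≤ (n : ℝ) ^ 2 := by positivity
    push_cast
    nlinarith
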